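/- Let $k$ be a commutative ring with unity, and let $G$ and $T$ be finite groups. For a finite group $H$, let $kB(H)$ be the Burnside group of $H$ with coefficients in $k$, i.e. $k\otimes_{\mathbb Z}B(H)$, with $B(H)$ the Grothendieck group of finite $H$-sets under disjoint union. *The essential algebra.* For finite groups $H,K$ put $kB_T(H\times K)=kB(H\times K\times T)$. For finite groups $H,K,L$, an $(H\times K\times T)$-set $X$ and a $(K\times L\times T)$-set $Y$, let $X\times_K^dY$ be the quotient of $X\times Y$ by the relation $(x,y)\sim((1,s,1)x,(s,1,1)y)$, $s\in K$, with the action $(h,l,t)[x,y]=[(h,1,t)x,(1,l,t)y]$ of $H\times L\times T$. Extended $k$-bilinearly, this gives $\times_K^d:kB_T(H\times K)\times kB_T(K\times L)\to kB_T(H\times L)$. Then $kB_T(G\times G)$ is a $k$-algebra with product $\times_G^d$. Let $\mathcal I_T(G)$ be its two-sided ideal generated by the elements $\alpha\times_K^d\beta$ with $K$ a finite group, $|K|<|G|$, $\alpha\in kB_T(G\times K)$ and $\beta\in kB_T(K\times G)$. Put $\widehat{kB_T}(G)=kB_T(G\times G)/\mathcal I_T(G)$. For $D\leqslant G\times G\times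 T$, let $[[D]]\in\widehat{kB_T}(G)$ be the image of the class of the transitive set $(G\times G\times T)/D$. *Three sets.* - $\mathcal G$ is the set of all $[[D]]$ with $D=\{(f(g,t),g,t)\mid (g,t)\in A\}$, where $A\leqslant G\times T$ projects onto $G$ and $f:A\to G$ is a surjective homomorphism such that, for $g\in G$ with $(g,1)\in A$, $f(g,1)=1$ implies $g=1$. - $\mathcal L_{s'}$ is the set of all $[[D]]$ such that $D$ cannot be written as $$E\ast F=\{(g,g',t)\mid \exists\, x\in H:\ (g,x,t)\in E,\ (x,g',t)\in F\}$$ with $H$ a finite group, $|H|<|G|$, $E\leqslant G\times H\times T$ and $F\leqslant H\times G\times T$. - $\mathcal L_p$ is the set of all $[[D_{\sigma,\alpha,T_0}]]$, where $D_{\sigma,\alpha,T_0}=\{(\alpha(t)\sigma(g),g,t)\mid g\in G,\ t\in T_0\}$, $\sigma\in \mathrm{Aut}(G)$, $T_0\leqslant T$ and $\alpha:T_0\to Z(G)$ is a homomorphism. *The algebra $kB^{Z(G)}(T)\rtimes Out(G)$.* Write $Z=Z(G)$. Let $kB^{Z}(T)$ be the submodule of $kB(T\times Z)$ generated by the classes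 of the $Z$-free $(T\times Z)$-sets. It is a ring with the bilinear product given by $[X][Y]=[X\times_ZY]$, where $X\times_ZY$ is the quotient of $X\times Y$ by the relation $((1,z)x,y)\sim(x,(1,z)y)$, $z\in Z$, with the action $(t,z)[x,y]=[(t,z)x,(t,1)y]$. For $\tau\in \mathrm{Aut}(G)$ and a $Z$-free $(T\times Z)$-set $U$, let $\tau(U)$ be the set $U$ with the action $(t,z)\cdot u=(t,\tau^{-1}(z))u$. This induces an action of $Out(G)=\mathrm{Aut}(G)/\mathrm{Inn}(G)$ on $kB^{Z}(T)$. Then $kB^{Z}(T)\rtimes Out(G)$ is the $k$-module $\bigoplus_{\sigma\in Out(G)}kB^{Z}(T)$ with the product $v_\tau\cdot u_\sigma=(v\,\tau(u))_{\tau\sigma}$, where $u_\sigma$ denotes $u$ placed in the component of $\sigma$. *Claim.* Suppose that $\gcd(|G|,|T|)=1$. Then $\mathcal L_p=\mathcal L_{s'}=\mathcal G$, and this set is a $k$-basis of $\widehat{kB_T}(G)$. Moreover there is an isomorphism of $k$-algebras $$\widehat{kB_T}(G)\cong kB^{Z(G)}(T)\rtimes Out(G),$$ and there is an isomorphism of $k$-modules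 $$kB_T(G\times G)\cong \bigl(kB^{Z(G)}(T)\rtimes Out(G)\bigr)\oplus\mathcal I_T(G).$$ -/

import Mathlib

open scoped TensorProduct

universe u v

namespace ShiftedBurnside

noncomputable section

/-! ### Finite `G`-sets and the Burnside group -/

/-- A finite left `G`-set. -/
structure GSet (G : Type u) [Group G] : Type (u + 1) where
  carrier : Type u
  [fin : Finite carrier]
  [act : MulAction G carrier]

attribute [instance] GSet.fin GSet.act

/-- Two finite `G`-sets are isomorphic if there is an equivariant bijection between them. -/
def GSet.Iso {G : Type u} [Group G] (X Y : GSet G) : Prop :=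
  ∃ e : X.carrier ≃ Y.carrier, ∀ (g : G) (x : X.carrier), e (g • x) = g • e x

theorem GSet.Iso.refl {G : Type u} [Group G] (X : GSet G) : X.Iso X :=
  ⟨Equiv.refl _, fun _ _ => rfl⟩

theorem GSet.Iso.symm {G : Type u} [Group G] {X Y : GSet G} (h : X.Iso Y) : Y.Iso X := by
  obtain ⟨e, he⟩ := h
  refine ⟨e.symm, fun g y => ?_⟩
  rw [Equiv.symm_apply_eq, he, Equiv.apply_symm_apply]

theorem GSet.Iso.trans {G : Type u} [Group G] {X Y Z : GSet G}
    (h : X.Iso Y) (h' : Y.Iso Z) : X.Iso Z := by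
  obtain ⟨e, he⟩ := h
  obtain ⟨f, hf⟩ := h'
  exact ⟨e.trans f, fun g x => by simp [he, hf]⟩

instance GSet.setoid (G : Type u) [Group G] : Setoid (GSet G) where
  r := GSet.Iso
  iseqv := ⟨GSet.Iso.refl, GSet.Iso.symm, GSet.Iso.trans⟩

/-- The disjoint union of two finite `G`-sets. -/
def GSet.sum {G : Type u} [Group G] (X Y : GSet G) : GSet G where
  carrier := X.carrier ⊕ Y.carrier

/-- The empty `G`-set. -/
def GSet.empty (G : Type u) [Group G] : GSet G where
  carrier := PEmpty
  act := { smul := fun _ x => x, one_smul := fun _ => rfl, mul_smul := fun _ _ _ => rfl }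

/-- The transitive `G`-set `G / D`, for a subgroup `D` of a finite group `G`. -/
def GSet.coset {G : Type u} [Group G] [Finite G] (D : Subgroup G) : GSet G where
  carrier := G ⧸ D

/-- Restriction of a `G`-set along a group homomorphism `H → G`. -/
def GSet.res {G H : Type u} [Group G] [Group H] (φ : H →* G) (X : GSet G) : GSet H where
  carrier := X.carrier
  act := MulAction.compHom X.carrier φ

/-- The set of isomorphism classes of finite `G`-sets. -/
def IsoClass (G : Type u) [Group G] : Type (u + 1) := Quotient (GSet.setoid G)

/-- The isomorphism class of a finite `G`-set. -/
def IsoClass.mk {G : Type u} [Group G] (X : GSet G) : IsoClass G := Quotient.mk _ X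

theorem IsoClass.mk_eq {G : Type u} [Group G] {X Y : GSet G} (h : X.Iso Y) :
    IsoClass.mk X = IsoClass.mk Y := Quotient.sound h

theorem GSet.Iso.sum {G : Type u} [Group G] {X X' Y Y' : GSet G}
    (h : X.Iso X') (h' : Y.Iso Y') : (X.sum Y).Iso (X'.sum Y') := by
  obtain ⟨e, he⟩ := h
  obtain ⟨f, hf⟩ := h'
  refine ⟨Equiv.sumCongr e f, ?_⟩
  rintro g (x | y)
  · exact congrArg Sum.inl (he g x)
  · exact congrArg Sum.inr (hf g y)

/-- Isomorphism classes of finite `G`-sets form a commutative monoid under disjoint union. -/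
instance IsoClass.addCommMonoid (G : Type u) [Group G] : AddCommMonoid (IsoClass G) where
  add := Quotient.map₂ GSet.sum fun _ _ h _ _ h' => h.sum h'
  zero := IsoClass.mk (GSet.empty G)
  nsmul := @nsmulRec _ ⟨IsoClass.mk (GSet.empty G)⟩
    ⟨Quotient.map₂ GSet.sum fun _ _ h _ _ h' => h.sum h'⟩
  add_assoc := by
    rintro ⟨X⟩ ⟨Y⟩ ⟨Z⟩
    refine Quotient.sound ⟨Equiv.sumAssoc _ _ _, ?_⟩
    rintro g ((x | y) | z) <;> rfl
  zero_add := by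
    rintro ⟨X⟩
    refine Quotient.sound ⟨Equiv.emptySum PEmpty X.carrier, ?_⟩
    rintro g (x | x)
    · exact x.elim
    · rfl
  add_zero := by
    rintro ⟨X⟩
    refine Quotient.sound ⟨Equiv.sumEmpty X.carrier PEmpty, ?_⟩
    rintro g (x | x)
    · rfl
    · exact x.elim
  add_comm := by
    rintro ⟨X⟩ ⟨Y⟩
    refine Quotient.sound ⟨Equiv.sumComm _ _, ?_⟩
    rintro g (x | x) <;> rfl

theorem IsoClass.mk_sum {G : Type u} [Group G] (X Y : GSet G) :
    IsoClass.mk (X.sum Y) = IsoClass.mk X + IsoClass.mk Y := rfl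

/-- The Burnside group `B(G)`: the Grothendieck group of the monoid of isomorphism classes of
finite `G`-sets under disjoint union. -/
def BurnsideGroup (G : Type u) [Group G] : Type (u + 1) :=
  Algebra.GrothendieckAddGroup (IsoClass G)

instance (G : Type u) [Group G] : AddCommGroup (BurnsideGroup G) :=
  inferInstanceAs (AddCommGroup (Algebra.GrothendieckAddGroup (IsoClass G)))

/-- The map from isomorphism classes of finite `G`-sets to the Burnside group. -/
def BurnsideGroup.of (G : Type u) [Group G] : IsoClass G →+ BurnsideGroup G :=
  Algebra.GrothendieckAddGroup.of

/-- The universal property of the Burnside group. -/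
def BurnsideGroup.lift {G : Type u} [Group G] {A : Type*} [AddCommGroup A] :
    (IsoClass G →+ A) ≃ (BurnsideGroup G →+ A) :=
  Algebra.GrothendieckAddGroup.lift

/-- The class `[X]` of a finite `G`-set in the Burnside group. -/
def BurnsideGroup.cls {G : Type u} [Group G] (X : GSet G) : BurnsideGroup G :=
  BurnsideGroup.of G (IsoClass.mk X)

theorem BurnsideGroup.lift_of {G : Type u} [Group G] {A : Type*} [AddCommGroup A]
    (f : IsoClass G →+ A) (x : IsoClass G) :
    BurnsideGroup.lift f (BurnsideGroup.of G x) = f x :=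
  DFunLike.congr_fun (BurnsideGroup.lift.symm_apply_apply f) x

theorem BurnsideGroup.hom_ext {G : Type u} [Group G] {A : Type*} [AddCommGroup A]
    {f g : BurnsideGroup G →+ A}
    (h : ∀ X : GSet G, f (BurnsideGroup.cls X) = g (BurnsideGroup.cls X)) : f = g := by
  apply BurnsideGroup.lift.symm.injective
  ext x
  obtain ⟨X, rfl⟩ := Quotient.exists_rep x
  exact h X

theorem BurnsideGroup.cls_eq {G : Type u} [Group G] {X Y : GSet G} (h : X.Iso Y) :
    BurnsideGroup.cls X = BurnsideGroup.cls Y :=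
  congrArg (BurnsideGroup.of G) (IsoClass.mk_eq h)

/-- The Burnside group `kB(G) = k ⊗ B(G)` with coefficients in `k`. -/
abbrev KBurnside (k : Type v) [CommRing k] (G : Type u) [Group G] : Type (max v (u + 1)) :=
  k ⊗[ℤ] BurnsideGroup G

/-! ### Amalgamated products of sets with group actions -/

/-- The data needed to form `X ×_K Y` from a `P`-set `X` and a `Q`-set `Y` and to let `R` act on
it: `K` acts on `X × Y` by `s • (x, y) = (a s • x, b s • y)` and `R` acts
by `r • (x, y) = (c r • x, d r • y)`, and these two actions commute. -/
structure AmalgData (K P Q R : Type u) [Group K] [Group P] [Group Q] [Group R] where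
  a : K →* P
  b : K →* Q
  c : R →* P
  d : R →* Q
  comm_left : ∀ s r, a s * c r = c r * a s
  comm_right : ∀ s r, b s * d r = d r * b s

section Amalg

variable {K P Q R : Type u} [Group K] [Group P] [Group Q] [Group R] (φ : AmalgData K P Q R)

/-- The orbit relation of `K` on `X × Y`. -/
def AmalgData.rel (X : GSet P) (Y : GSet Q) : Setoid (X.carrier × Y.carrier) where
  r p q := ∃ s : K, (φ.a s • p.1, φ.b s • p.2) = q
  iseqv :=
    { refl := fun p => ⟨1, by simp⟩
      symm := by
        rintro p q ⟨s, rfl⟩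
        exact ⟨s⁻¹, by simp⟩
      trans := by
        rintro p q r ⟨s, rfl⟩ ⟨t, rfl⟩
        exact ⟨t * s, by simp [mul_smul]⟩ }

/-- The `R`-set `X ×_K Y` of `K`-orbits on `X × Y`. -/
def AmalgData.prod (X : GSet P) (Y : GSet Q) : GSet R where
  carrier := Quotient (φ.rel X Y)
  act :=
    { smul := fun r => Quotient.map (fun p => (φ.c r • p.1, φ.d r • p.2)) (by
        rintro p q ⟨s, rfl⟩
        exact ⟨s, by simp [← mul_smul, φ.comm_left, φ.comm_right]⟩)
      one_smul := by
        rintro ⟨x, y⟩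
        refine Quotient.sound ⟨1, ?_⟩
        simp
      mul_smul := by
        rintro r s ⟨x, y⟩
        refine Quotient.sound ⟨1, ?_⟩
        simp [mul_smul] }

/-- The class `[x, y]` in `X ×_K Y`. -/
def AmalgData.pt {X : GSet P} {Y : GSet Q} (x : X.carrier) (y : Y.carrier) :
    (φ.prod X Y).carrier := Quotient.mk (φ.rel X Y) (x, y)

theorem AmalgData.smul_pt {X : GSet P} {Y : GSet Q} (r : R) (x : X.carrier) (y : Y.carrier) :
    r • φ.pt x y = φ.pt (φ.c r • x) (φ.d r • y) := rfl

theorem AmalgData.pt_eq_iff {X : GSet P} {Y : GSet Q} {x x' : X.carrier} {y y' : Y.carrier} :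
    φ.pt x y = φ.pt x' y' ↔ ∃ s : K, φ.a s • x = x' ∧ φ.b s • y = y' := by
  refine Quotient.eq.trans (exists_congr fun s => ?_)
  exact Prod.ext_iff

theorem AmalgData.pt_smul {X : GSet P} {Y : GSet Q} (s : K) (x : X.carrier) (y : Y.carrier) :
    φ.pt (φ.a s • x) (φ.b s • y) = φ.pt x y :=
  ((φ.pt_eq_iff).2 ⟨s, rfl, rfl⟩).symm

theorem AmalgData.ind {X : GSet P} {Y : GSet Q} {p : (φ.prod X Y).carrier → Prop}
    (h : ∀ x y, p (φ.pt x y)) (z) : p z :=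
  Quotient.ind (fun ⟨x, y⟩ => h x y) z

/-- A criterion for recognizing `X ×_K Y` up to isomorphism. -/
theorem AmalgData.iso_of {X : GSet P} {Y : GSet Q} {Z : GSet R}
    (f : X.carrier → Y.carrier → Z.carrier)
    (hf : ∀ s x y, f (φ.a s • x) (φ.b s • y) = f x y)
    (hinj : ∀ x y x' y', f x y = f x' y' → ∃ s, φ.a s • x = x' ∧ φ.b s • y = y')
    (hsurj : ∀ z, ∃ x y, f x y = z)
    (hr : ∀ r x y, f (φ.c r • x) (φ.d r • y) = r • f x y) : (φ.prod X Y).Iso Z := by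
  let F : (φ.prod X Y).carrier → Z.carrier := Quotient.lift (fun p => f p.1 p.2) (by
    rintro p q ⟨s, rfl⟩
    exact (hf s _ _).symm)
  have hF : Function.Bijective F := by
    constructor
    · refine φ.ind fun x y => φ.ind fun x' y' => ?_
      intro h
      exact (φ.pt_eq_iff).2 (hinj x y x' y' h)
    · intro z
      obtain ⟨x, y, h⟩ := hsurj z
      exact ⟨φ.pt x y, h⟩
  exact ⟨Equiv.ofBijective F hF, fun r => φ.ind fun x y => hr r x y⟩

theorem AmalgData.prod_iso {X X' : GSet P} {Y Y' : GSet Q} (h : X.Iso X') (h' : Y.Iso Y') :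
    (φ.prod X Y).Iso (φ.prod X' Y') := by
  obtain ⟨e, he⟩ := h
  obtain ⟨f, hf⟩ := h'
  refine φ.iso_of (fun x y => φ.pt (e x) (f y)) ?_ ?_ ?_ ?_
  · intro s x y
    rw [he, hf, φ.pt_smul]
  · intro x y x' y' h
    obtain ⟨s, h1, h2⟩ := (φ.pt_eq_iff).1 h
    exact ⟨s, e.injective (by rw [he, h1]), f.injective (by rw [hf, h2])⟩
  · refine φ.ind fun x y => ⟨e.symm x, f.symm y, by simp⟩
  · intro r x y
    rw [he, hf, φ.smul_pt]

theorem AmalgData.sum_prod (X X' : GSet P) (Y : GSet Q) :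
    (φ.prod (X.sum X') Y).Iso ((φ.prod X Y).sum (φ.prod X' Y)) := by
  refine φ.iso_of
    (fun x y => Sum.elim (fun x => Sum.inl (φ.pt x y)) (fun x => Sum.inr (φ.pt x y)) x)
    ?_ ?_ ?_ ?_
  · rintro s (x | x) y
    · exact congrArg Sum.inl (φ.pt_smul s x y)
    · exact congrArg Sum.inr (φ.pt_smul s x y)
  · rintro (x | x) y (x' | x') y' h
    · obtain ⟨s, h1, h2⟩ := (φ.pt_eq_iff).1 (Sum.inl_injective h)
      exact ⟨s, congrArg Sum.inl h1, h2⟩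
    · exact (Sum.inl_ne_inr h).elim
    · exact (Sum.inr_ne_inl h).elim
    · obtain ⟨s, h1, h2⟩ := (φ.pt_eq_iff).1 (Sum.inr_injective h)
      exact ⟨s, congrArg Sum.inr h1, h2⟩
  · rintro (z | z)
    · revert z
      exact φ.ind fun x y => ⟨Sum.inl x, y, rfl⟩
    · revert z
      exact φ.ind fun x y => ⟨Sum.inr x, y, rfl⟩
  · rintro r (x | x) y <;> rfl

theorem AmalgData.prod_sum (X : GSet P) (Y Y' : GSet Q) :
    (φ.prod X (Y.sum Y')).Iso ((φ.prod X Y).sum (φ.prod X Y')) := by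
  refine φ.iso_of
    (fun x y => Sum.elim (fun y => Sum.inl (φ.pt x y)) (fun y => Sum.inr (φ.pt x y)) y)
    ?_ ?_ ?_ ?_
  · rintro s x (y | y)
    · exact congrArg Sum.inl (φ.pt_smul s x y)
    · exact congrArg Sum.inr (φ.pt_smul s x y)
  · rintro x (y | y) x' (y' | y') h
    · obtain ⟨s, h1, h2⟩ := (φ.pt_eq_iff).1 (Sum.inl_injective h)
      exact ⟨s, h1, congrArg Sum.inl h2⟩
    · exact (Sum.inl_ne_inr h).elim
    · exact (Sum.inr_ne_inl h).elim
    · obtain ⟨s, h1, h2⟩ := (φ.pt_eq_iff).1 (Sum.inr_injective h)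
      exact ⟨s, h1, congrArg Sum.inr h2⟩
  · rintro (z | z)
    · revert z
      exact φ.ind fun x y => ⟨x, Sum.inl y, rfl⟩
    · revert z
      exact φ.ind fun x y => ⟨x, Sum.inr y, rfl⟩
  · rintro r x (y | y) <;> rfl

theorem AmalgData.empty_prod (Y : GSet Q) : (φ.prod (GSet.empty P) Y).Iso (GSet.empty R) :=
  φ.iso_of (fun x _ => x) (fun _ _ _ => rfl) (fun x => x.elim) (fun x => x.elim)
    (fun _ _ _ => rfl)

theorem AmalgData.prod_empty (X : GSet P) : (φ.prod X (GSet.empty Q)).Iso (GSet.empty R) :=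
  φ.iso_of (fun _ y => y) (fun _ _ _ => rfl) (fun _ y => y.elim) (fun y => y.elim)
    (fun _ _ _ => rfl)

/-- A map out of `X ×_K Y`. -/
def AmalgData.liftFun {X : GSet P} {Y : GSet Q} {A : Type*} (f : X.carrier → Y.carrier → A)
    (hf : ∀ s x y, f (φ.a s • x) (φ.b s • y) = f x y) : (φ.prod X Y).carrier → A :=
  Quotient.lift (fun p => f p.1 p.2) (by
    rintro p q ⟨s, rfl⟩
    exact (hf s _ _).symm)

/-- A criterion for `(X ×_K Y) ×_L Z` and `X ×_K (Y ×_L Z)` to be isomorphic. -/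
theorem AmalgData.assoc_iso {L S U V : Type u} [Group L] [Group S] [Group U] [Group V]
    (φ₂ : AmalgData L R S U) (ψ₁ : AmalgData L Q S V) (ψ₂ : AmalgData K P V U)
    {X : GSet P} {Y : GSet Q} {Z : GSet S}
    (h1 : ∀ s (x : X.carrier) (y : Y.carrier) (z : Z.carrier),
      ψ₂.pt (φ.a s • x) (ψ₁.pt (φ.b s • y) z) = ψ₂.pt x (ψ₁.pt y z))
    (h2 : ∀ l (x : X.carrier) (y : Y.carrier) (z : Z.carrier),
      ψ₂.pt (φ.c (φ₂.a l) • x) (ψ₁.pt (φ.d (φ₂.a l) • y) (φ₂.b l • z)) =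
        ψ₂.pt x (ψ₁.pt y z))
    (h3 : ∀ l (x : X.carrier) (y : Y.carrier) (z : Z.carrier),
      φ₂.pt (φ.pt x (ψ₁.a l • y)) (ψ₁.b l • z) = φ₂.pt (φ.pt x y) z)
    (h4 : ∀ s (x : X.carrier) (y : Y.carrier) (z : Z.carrier),
      φ₂.pt (φ.pt (ψ₂.a s • x) (ψ₁.c (ψ₂.b s) • y)) (ψ₁.d (ψ₂.b s) • z) =
        φ₂.pt (φ.pt x y) z)
    (h5 : ∀ r (x : X.carrier) (y : Y.carrier) (z : Z.carrier),
      ψ₂.pt (φ.c (φ₂.c r) • x) (ψ₁.pt (φ.d (φ₂.c r) • y) (φ₂.d r • z)) =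
        r • ψ₂.pt x (ψ₁.pt y z)) :
    (φ₂.prod (φ.prod X Y) Z).Iso (ψ₂.prod X (ψ₁.prod Y Z)) := by
  refine ⟨⟨φ₂.liftFun (fun w z => φ.liftFun (fun x y => ψ₂.pt x (ψ₁.pt y z)) ?_ w) ?_,
    ψ₂.liftFun (fun x w => ψ₁.liftFun (fun y z => φ₂.pt (φ.pt x y) z) ?_ w) ?_, ?_, ?_⟩, ?_⟩
  · exact fun s x y => h1 s x y z
  · intro l w z
    revert w
    exact φ.ind fun x y => h2 l x y z
  · exact fun l y z => h3 l x y z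
  · intro s x w
    revert w
    exact ψ₁.ind fun y z => h4 s x y z
  · refine φ₂.ind fun w z => ?_
    revert w
    exact φ.ind fun x y => rfl
  · refine ψ₂.ind fun x w => ?_
    revert w
    exact ψ₁.ind fun y z => rfl
  · intro r
    refine φ₂.ind fun w z => ?_
    revert w
    exact φ.ind fun x y => h5 r x y z

/-- `(X, Y) ↦ X ×_K Y` on isomorphism classes. -/
def AmalgData.isoProd : IsoClass P →+ IsoClass Q →+ IsoClass R where
  toFun x :=
    { toFun := fun y => Quotient.map₂ φ.prod (fun _ _ h _ _ h' => φ.prod_iso h h') x y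
      map_zero' := by
        obtain ⟨X, rfl⟩ := Quotient.exists_rep x
        exact Quotient.sound (φ.prod_empty X)
      map_add' := by
        obtain ⟨X, rfl⟩ := Quotient.exists_rep x
        rintro ⟨Y⟩ ⟨Y'⟩
        exact Quotient.sound (φ.prod_sum X Y Y') }
  map_zero' := by
    ext y
    obtain ⟨Y, rfl⟩ := Quotient.exists_rep y
    exact Quotient.sound (φ.empty_prod Y)
  map_add' := by
    rintro ⟨X⟩ ⟨X'⟩
    ext y
    obtain ⟨Y, rfl⟩ := Quotient.exists_rep y
    exact Quotient.sound (φ.sum_prod X X' Y)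

/-- The biadditive extension of `([X], [Y]) ↦ [X ×_K Y]` to Burnside groups. -/
def AmalgData.bprod : BurnsideGroup P →+ BurnsideGroup Q →+ BurnsideGroup R :=
  BurnsideGroup.lift
    { toFun := fun x => BurnsideGroup.lift ((BurnsideGroup.of R).comp (φ.isoProd x))
      map_zero' := BurnsideGroup.hom_ext fun Y => by
        simp [BurnsideGroup.cls, BurnsideGroup.lift_of]
      map_add' := fun x x' => BurnsideGroup.hom_ext fun Y => by
        simp [BurnsideGroup.cls, BurnsideGroup.lift_of] }

theorem AmalgData.bprod_cls (X : GSet P) (Y : GSet Q) :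
    φ.bprod (BurnsideGroup.cls X) (BurnsideGroup.cls Y) = BurnsideGroup.cls (φ.prod X Y) := by
  simp only [AmalgData.bprod, BurnsideGroup.cls, BurnsideGroup.lift_of, AddMonoidHom.coe_mk,
    ZeroHom.coe_mk]
  rfl

end Amalg

theorem BurnsideGroup.ind {G : Type u} [Group G] {p : BurnsideGroup G → Prop}
    (hcls : ∀ X, p (BurnsideGroup.cls X)) (hadd : ∀ a b, p a → p b → p (a + b))
    (hneg : ∀ a, p a → p (-a)) (a : BurnsideGroup G) : p a := by
  have h0 : p 0 := by
    have := hadd _ _ (hcls (GSet.empty G)) (hneg _ (hcls (GSet.empty G)))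
    rwa [add_neg_cancel] at this
  let S : AddSubgroup (BurnsideGroup G) :=
    { carrier := {x | p x}
      zero_mem' := h0
      add_mem' := fun {a b} ha hb => hadd a b ha hb
      neg_mem' := fun {a} ha => hneg a ha }
  have h : (QuotientAddGroup.mk' S) = 0 := BurnsideGroup.hom_ext fun X =>
    (QuotientAddGroup.eq_zero_iff (N := S) _).2 (hcls X)
  exact (QuotientAddGroup.eq_zero_iff (N := S) a).1 (DFunLike.congr_fun h a)

section Bilinear

theorem AmalgData.bprod_assoc {K P Q R L S U V : Type u} [Group K] [Group P] [Group Q] [Group R]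
    [Group L] [Group S] [Group U] [Group V]
    (φ : AmalgData K P Q R) (φ₂ : AmalgData L R S U) (ψ₁ : AmalgData L Q S V)
    (ψ₂ : AmalgData K P V U)
    (h : ∀ X Y Z, (φ₂.prod (φ.prod X Y) Z).Iso (ψ₂.prod X (ψ₁.prod Y Z)))
    (x : BurnsideGroup P) (y : BurnsideGroup Q) (z : BurnsideGroup S) :
    φ₂.bprod (φ.bprod x y) z = ψ₂.bprod x (ψ₁.bprod y z) := by
  induction x using BurnsideGroup.ind with
  | hadd a b ha hb => simp only [map_add, AddMonoidHom.add_apply, ha, hb]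
  | hneg a ha => simp only [map_neg, AddMonoidHom.neg_apply, ha]
  | hcls X =>
  induction y using BurnsideGroup.ind with
  | hadd a b ha hb => simp only [map_add, AddMonoidHom.add_apply, ha, hb]
  | hneg a ha => simp only [map_neg, AddMonoidHom.neg_apply, ha]
  | hcls Y =>
  induction z using BurnsideGroup.ind with
  | hadd a b ha hb => simp only [map_add, ha, hb]
  | hneg a ha => simp only [map_neg, ha]
  | hcls Z =>
    simp only [AmalgData.bprod_cls]
    exact BurnsideGroup.cls_eq (h X Y Z)

theorem AmalgData.bprod_left_unit {K P Q : Type u} [Group K] [Group P] [Group Q]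
    (φ : AmalgData K P Q Q) (I : GSet P) (h : ∀ X, (φ.prod I X).Iso X) (x : BurnsideGroup Q) :
    φ.bprod (BurnsideGroup.cls I) x = x := by
  induction x using BurnsideGroup.ind with
  | hadd a b ha hb => simp only [map_add, ha, hb]
  | hneg a ha => simp only [map_neg, ha]
  | hcls X =>
    rw [AmalgData.bprod_cls]
    exact BurnsideGroup.cls_eq (h X)

theorem AmalgData.bprod_right_unit {K P Q : Type u} [Group K] [Group P] [Group Q]
    (φ : AmalgData K P Q P) (I : GSet Q) (h : ∀ X, (φ.prod X I).Iso X) (x : BurnsideGroup P) :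
    φ.bprod x (BurnsideGroup.cls I) = x := by
  induction x using BurnsideGroup.ind with
  | hadd a b ha hb => simp only [map_add, AddMonoidHom.add_apply, ha, hb]
  | hneg a ha => simp only [map_neg, AddMonoidHom.neg_apply, ha]
  | hcls X =>
    rw [AmalgData.bprod_cls]
    exact BurnsideGroup.cls_eq (h X)

end Bilinear

/-! ### The shifted Burnside category -/

section Composition

variable (H K L T : Type u) [Group H] [Group K] [Group L] [Group T]

/-- The data of the composition `X ×_K^d Y` of an `H × K × T`-set `X` and a `K × L × T`-set `Y`:
`X ×_K^d Y` is the quotient of `X × Y` by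
`(x, y) ∼ ((1, s, 1) • x, (s, 1, 1) • y)` for `s` in `K`, on which `H × L × T` acts
by `(h, l, t) • [x, y] = [(h, 1, t) • x, (1, l, t) • y]`. -/
def compData : AmalgData K (H × K × T) (K × L × T) (H × L × T) where
  a := MonoidHom.mk' (fun s => (1, s, 1)) (by simp)
  b := MonoidHom.mk' (fun s => (s, 1, 1)) (by simp)
  c := MonoidHom.mk' (fun r => (r.1, 1, r.2.2)) (by simp)
  d := MonoidHom.mk' (fun r => (1, r.2.1, r.2.2)) (by simp)
  comm_left := by simp
  comm_right := by simp

end Composition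

/-- The `G × G × T`-set `G`, with action `(g₁, g₂, t) • x = g₁ * x * g₂⁻¹`. It is isomorphic
to `(G × G × T) / (Δ(G) × T)`. -/
def GSet.diag (G T : Type u) [Group G] [Finite G] [Group T] : GSet (G × G × T) where
  carrier := G
  act :=
    { smul := fun r x => r.1 * x * r.2.1⁻¹
      one_smul := fun x => by
        change (1 : G) * x * (1 : G)⁻¹ = x
        simp
      mul_smul := fun r s x => by
        change (r.1 * s.1) * x * (r.2.1 * s.2.1)⁻¹ = r.1 * (s.1 * x * s.2.1⁻¹) * r.2.1⁻¹
        simp [mul_assoc] }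

theorem comp_assoc {H K L M T : Type u} [Group H] [Group K] [Group L] [Group M] [Group T]
    (X : GSet (H × K × T)) (Y : GSet (K × L × T)) (Z : GSet (L × M × T)) :
    ((compData H L M T).prod ((compData H K L T).prod X Y) Z).Iso
      ((compData H K M T).prod X ((compData K L M T).prod Y Z)) := by
  have one_smul' : ∀ {A B C : Type u} [Group A] [Group B] [Group C] (W : GSet (A × B × C))
      (w : W.carrier), ((1 : A), (1 : B), (1 : C)) • w = w := fun _ w => one_smul _ w
  refine AmalgData.assoc_iso _ _ _ _ ?_ ?_ ?_ ?_ ?_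
  · intro s x y z
    rw [← AmalgData.pt_smul (compData H K M T) s x, AmalgData.smul_pt]
    simp [compData, one_smul']
  · intro l x y z
    rw [← AmalgData.pt_smul (compData K L M T) l y z]
    simp [compData, one_smul']
  · intro l x y z
    rw [← AmalgData.pt_smul (compData H L M T) l _ z, AmalgData.smul_pt]
    simp [compData, one_smul']
  · intro s x y z
    rw [← AmalgData.pt_smul (compData H K L T) s x y]
    simp [compData, one_smul']
  · intro r x y z
    rw [AmalgData.smul_pt, AmalgData.smul_pt]
    simp [compData]

theorem diag_comp {H K T : Type u} [Group H] [Finite H] [Group K] [Group T]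
    (Y : GSet (H × K × T)) : ((compData H H K T).prod (GSet.diag H T) Y).Iso Y := by
  refine (compData H H K T).iso_of (fun (h : H) y => (h, (1 : K), (1 : T)) • y) ?_ ?_ ?_ ?_
  · intro s (x : H) y
    change ((1 * x * s⁻¹ : H), (1 : K), (1 : T)) • (s, (1 : K), (1 : T)) • y = _
    simp [← mul_smul]
  · intro (x : H) y (x' : H) y' h
    change (x, (1 : K), (1 : T)) • y = (x', (1 : K), (1 : T)) • y' at h
    refine ⟨(x'⁻¹ * x : H), ?_, ?_⟩
    · change 1 * x * (x'⁻¹ * x : H)⁻¹ = x'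
      simp
    · change ((x'⁻¹ * x : H), (1 : K), (1 : T)) • y = y'
      rw [← inv_smul_eq_iff] at h
      rw [← h, ← mul_smul]
      simp
  · intro z
    exact ⟨(1 : H), z, one_smul _ z⟩
  · intro r (x : H) y
    change ((r.1 * x * 1⁻¹ : H), (1 : K), (1 : T)) • ((1 : H), r.2.1, r.2.2) • y =
      r • (x, (1 : K), (1 : T)) • y
    rw [← mul_smul, ← mul_smul]
    congr 1
    ext <;> simp

theorem comp_diag {H K T : Type u} [Group H] [Group K] [Finite K] [Group T]
    (X : GSet (H × K × T)) : ((compData H K K T).prod X (GSet.diag K T)).Iso X := by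
  refine (compData H K K T).iso_of (fun x (s : K) => ((1 : H), s⁻¹, (1 : T)) • x) ?_ ?_ ?_ ?_
  · intro s x (y : K)
    change ((1 : H), (s * y * 1⁻¹ : K)⁻¹, (1 : T)) • ((1 : H), s, (1 : T)) • x = _
    simp [← mul_smul]
  · intro x (y : K) x' (y' : K) h
    change ((1 : H), (y : K)⁻¹, (1 : T)) • x = ((1 : H), (y' : K)⁻¹, (1 : T)) • x' at h
    refine ⟨(y' * y⁻¹ : K), ?_, ?_⟩
    · change ((1 : H), (y' * y⁻¹ : K), (1 : T)) • x = x'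
      rw [eq_comm, ← inv_smul_eq_iff, ← mul_smul] at h
      rw [← h, ← mul_smul]
      have e : ((1 : H), (y' * y⁻¹ : K), (1 : T)) *
          (((1 : H), (y : K)⁻¹, (1 : T))⁻¹ * ((1 : H), (y' : K)⁻¹, (1 : T))) = 1 := by
        ext <;> simp
      rw [e, one_smul]
    · change (y' * y⁻¹ : K) * y * 1⁻¹ = y'
      simp
  · intro z
    refine ⟨z, (1 : K), ?_⟩
    rw [inv_one]
    exact one_smul _ z
  · intro r x (y : K)
    change ((1 : H), (1 * y * r.2.1⁻¹ : K)⁻¹, (1 : T)) • (r.1, (1 : K), r.2.2) • x =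
      r • ((1 : H), (y : K)⁻¹, (1 : T)) • x
    rw [← mul_smul, ← mul_smul]
    congr 1
    ext <;> simp

/-- The endomorphism ring `B_T(G × G)` of `G` in the shifted Burnside category: the Burnside group
`B(G × G × T)`, with the product `×_G^d`. -/
def EndB (G T : Type u) [Group G] [Group T] : Type (u + 1) := BurnsideGroup (G × G × T)

instance (G T : Type u) [Group G] [Group T] : AddCommGroup (EndB G T) :=
  inferInstanceAs (AddCommGroup (BurnsideGroup (G × G × T)))

instance EndB.ring (G T : Type u) [Group G] [Finite G] [Group T] : Ring (EndB G T) where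
  __ := (inferInstance : AddCommGroup (EndB G T))
  mul x y := (compData G G G T).bprod x y
  one := BurnsideGroup.cls (GSet.diag G T)
  left_distrib x y z := map_add ((compData G G G T).bprod x) y z
  right_distrib x y z := DFunLike.congr_fun (map_add (compData G G G T).bprod x y) z
  zero_mul x := DFunLike.congr_fun (map_zero (compData G G G T).bprod) x
  mul_zero x := map_zero ((compData G G G T).bprod x)
  mul_assoc := AmalgData.bprod_assoc _ _ _ _ comp_assoc
  one_mul := AmalgData.bprod_left_unit _ _ diag_comp
  mul_one := AmalgData.bprod_right_unit _ _ comp_diag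

/-- The identity map from `B(G × G × T)` to the endomorphism ring. -/
def EndB.of {G T : Type u} [Group G] [Group T] : BurnsideGroup (G × G × T) ≃+ EndB G T :=
  AddEquiv.refl _

theorem EndB.of_mul {G T : Type u} [Group G] [Finite G] [Group T]
    (x y : BurnsideGroup (G × G × T)) :
    EndB.of x * EndB.of y = EndB.of ((compData G G G T).bprod x y) := rfl

/-- The endomorphism algebra `kB_T(G × G) = k ⊗ B_T(G × G)`. -/
abbrev KEndB (k : Type v) [CommRing k] (G T : Type u) [Group G] [Finite G] [Group T] :
    Type (max v (u + 1)) :=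
  k ⊗[ℤ] EndB G T

/-- The composition `×_K^d : kB_T(G × K) × kB_T(K × G) → kB_T(G × G)`, the `k`-bilinear extension
of `([X], [Y]) ↦ [X ×_K^d Y]`. -/
def kcomp (k : Type v) [CommRing k] (G K T : Type u) [Group G] [Finite G] [Group K] [Group T]
    (x : KBurnside k (G × K × T)) (y : KBurnside k (K × G × T)) : KEndB k G T :=
  TensorProduct.map₂ (LinearMap.mul ℤ k)
    (LinearMap.mk₂ ℤ (fun a b => EndB.of ((compData G K G T).bprod a b))
      (fun a b c => by simp) (fun n a c => by simp) (fun a b c => by simp)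
      (fun n a b => by simp)) x y

theorem kcomp_tmul (k : Type v) [CommRing k] (G K T : Type u) [Group G] [Finite G] [Group K]
    [Group T] (r s : k) (a : BurnsideGroup (G × K × T)) (b : BurnsideGroup (K × G × T)) :
    kcomp k G K T (r ⊗ₜ a) (s ⊗ₜ b) = (r * s) ⊗ₜ EndB.of ((compData G K G T).bprod a b) := rfl

/-! ### The essential algebra -/

section Essential

variable (k : Type v) [CommRing k] (G T : Type u) [Group G] [Finite G] [Group T]

/-- The two-sided ideal `I_T(G)` of `kB_T(G × G)` generated by the elements `α ×_K^d β` for `α` in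
`kB_T(G × K)`, `β` in `kB_T(K × G)` and `K` a finite group with `|K| < |G|`. -/
def factorIdeal : Ideal (KEndB k G T) :=
  (TwoSidedIdeal.span {x : KEndB k G T |
    ∃ (K : Type u) (_ : Group K) (_ : Finite K), Nat.card K < Nat.card G ∧
      ∃ (α : KBurnside k (G × K × T)) (β : KBurnside k (K × G × T)),
        x = kcomp k G K T α β}).asIdeal

instance : (factorIdeal k G T).IsTwoSided := by
  unfold factorIdeal
  infer_instance

/-- The essential algebra of `kB_T` at `G`. -/
abbrev EssentialAlgebra : Type (max v (u + 1)) := KEndB k G T ⧸ factorIdeal k G T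

/-- The natural epimorphism from `kB_T(G × G)` to the essential algebra. -/
def essProj : KEndB k G T →ₐ[k] EssentialAlgebra k G T :=
  Ideal.Quotient.mkₐ k (factorIdeal k G T)

variable [Finite T]

/-- The class `[(G × G × T) / D]` in `kB_T(G × G)`. -/
def transCls (D : Subgroup (G × G × T)) : KEndB k G T :=
  (1 : k) ⊗ₜ[ℤ] EndB.of (BurnsideGroup.cls (GSet.coset D))

end Essential

/-- For `D ≤ H × K × T` and `E ≤ K × L × T`, the subgroup `D ∗ E` of `H × L × T` of all `(h, l, t)`
such that `(h, x, t) ∈ D` and `(x, l, t) ∈ E` for some `x` in `K`. -/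
def starProd {H K L T : Type u} [Group H] [Group K] [Group L] [Group T]
    (D : Subgroup (H × K × T)) (E : Subgroup (K × L × T)) : Subgroup (H × L × T) where
  carrier := {p | ∃ x : K, (p.1, x, p.2.2) ∈ D ∧ (x, p.2.1, p.2.2) ∈ E}
  one_mem' := ⟨1, D.one_mem, E.one_mem⟩
  mul_mem' := by
    rintro p q ⟨x, hx, hx'⟩ ⟨y, hy, hy'⟩
    exact ⟨x * y, D.mul_mem hx hy, E.mul_mem hx' hy'⟩
  inv_mem' := by
    rintro p ⟨x, hx, hx'⟩
    exact ⟨x⁻¹, D.inv_mem hx, E.inv_mem hx'⟩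

/-- `D` can be written as `E ∗ F` with `E ≤ G × H × T` and `F ≤ H × G × T` for a finite group `H`
with `|H| < |G|`. -/
def StarDecomposable {G T : Type u} [Group G] [Group T] (D : Subgroup (G × G × T)) : Prop :=
  ∃ (H : Type u) (_ : Group H) (_ : Finite H), Nat.card H < Nat.card G ∧
    ∃ (E : Subgroup (G × H × T)) (F : Subgroup (H × G × T)), D = starProd E F

/-- The graph `{(f (g, t), g, t) | (g, t) ∈ A}` of a homomorphism `f : A → G`, where `A ≤ G × T`. -/
def graphSubgroup {G T : Type u} [Group G] [Group T] (A : Subgroup (G × T)) (f : A →* G) :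
    Subgroup (G × G × T) where
  carrier := {p | ∃ h : (p.2.1, p.2.2) ∈ A, p.1 = f ⟨(p.2.1, p.2.2), h⟩}
  one_mem' := ⟨A.one_mem, (map_one f).symm⟩
  mul_mem' := by
    rintro p q ⟨h, e⟩ ⟨h', e'⟩
    exact ⟨A.mul_mem h h', by
      rw [Prod.fst_mul, e, e', ← map_mul]
      rfl⟩
  inv_mem' := by
    rintro p ⟨h, e⟩
    exact ⟨A.inv_mem h, by
      rw [Prod.fst_inv, e, ← map_inv]
      rfl⟩

/-- The subgroup `D_{σ, α, T₀} = {(α t * σ g, g, t) | g ∈ G, t ∈ T₀}` of `G × G × T`, for an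
automorphism `σ` of `G` and a homomorphism `α` from `T₀ ≤ T` to the center of `G`. -/
def directSubgroup {G T : Type u} [Group G] [Group T] (σ : MulAut G) (T₀ : Subgroup T)
    (α : T₀ →* Subgroup.center G) : Subgroup (G × G × T) where
  carrier := {p | ∃ h : p.2.2 ∈ T₀, p.1 = (α ⟨p.2.2, h⟩ : G) * σ p.2.1}
  one_mem' := ⟨T₀.one_mem, by
    change (1 : G) = (α 1 : G) * σ 1
    simp⟩
  mul_mem' := by
    rintro p q ⟨h, e⟩ ⟨h', e'⟩
    refine ⟨T₀.mul_mem h h', ?_⟩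
    have h1 : α ⟨(p * q).2.2, T₀.mul_mem h h'⟩ = α ⟨p.2.2, h⟩ * α ⟨q.2.2, h'⟩ := by
      rw [← map_mul]
      rfl
    have h2 := Subgroup.mem_center_iff.1 (α ⟨q.2.2, h'⟩).2 (σ p.2.1)
    rw [h1, Prod.fst_mul, e, e', Prod.snd_mul, Prod.fst_mul, map_mul, Subgroup.coe_mul]
    simp only [mul_assoc]
    rw [← mul_assoc (σ p.2.1), h2, mul_assoc]
  inv_mem' := by
    rintro p ⟨h, e⟩
    refine ⟨T₀.inv_mem h, ?_⟩
    have h1 : α ⟨(p⁻¹).2.2, T₀.inv_mem h⟩ = (α ⟨p.2.2, h⟩)⁻¹ := by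
      rw [← map_inv]
      rfl
    have h2 := Subgroup.mem_center_iff.1 ((α ⟨p.2.2, h⟩)⁻¹).2 (σ p.2.1)⁻¹
    rw [h1, Prod.fst_inv, e, Prod.snd_inv, Prod.fst_inv, map_inv, ← h2, mul_inv_rev,
      Subgroup.coe_inv]

section Generators

variable (k : Type v) [CommRing k] (G T : Type u) [Group G] [Finite G] [Group T] [Finite T]

/-- The set `𝓖` of images in the essential algebra of the classes `[(G × G × T) / D]`, where
`D = {(f (g, t), g, t) | (g, t) ∈ A}` for a subgroup `A ≤ G × T` projecting onto `G` and a
surjective homomorphism `f : A → G` with `Ker f ∩ (k₁(A) × 1) = 1`. -/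
def setG : Set (EssentialAlgebra k G T) :=
  {x | ∃ (A : Subgroup (G × T)) (f : A →* G),
    (∀ g : G, ∃ t : T, (g, t) ∈ A) ∧ Function.Surjective f ∧
    (∀ (g : G) (h : (g, (1 : T)) ∈ A), f ⟨(g, 1), h⟩ = 1 → g = 1) ∧
    x = essProj k G T (transCls k G T (graphSubgroup A f))}

/-- The set `𝓛_{s'}` of images in the essential algebra of the classes `[(G × G × T) / D]`, where
`D` cannot be written as `E ∗ F` with `E ≤ G × H × T`, `F ≤ H × G × T` and `|H| < |G|`. -/
def setLs : Set (EssentialAlgebra k G T) :=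
  {x | ∃ D : Subgroup (G × G × T), ¬ StarDecomposable D ∧ x = essProj k G T (transCls k G T D)}

/-- The set `𝓛_p` of images in the essential algebra of the classes
`[(G × G × T) / D_{σ, α, T₀}]`. -/
def setLp : Set (EssentialAlgebra k G T) :=
  {x | ∃ (σ : MulAut G) (T₀ : Subgroup T) (α : T₀ →* Subgroup.center G),
    x = essProj k G T (transCls k G T (directSubgroup σ T₀ α))}

end Generators

/-! ### The monomial Burnside ring -/

section Monomial

variable (T C : Type u) [Group T] [CommGroup C]

/-- The data of the product `X ×_C Y` of two `T × C`-sets, for an abelian group `C`: with `C` also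
acting on the right on `X` by `x * z = (1, z) • x`, it is the quotient of `X × Y` by
`(x * z, y) ∼ (x, (1, z) • y)`, on which `T × C` acts
by `(t, z) • [x, y] = [(t, z) • x, (t, 1) • y]`. -/
def fibData : AmalgData C (T × C) (T × C) (T × C) where
  a := MonoidHom.mk' (fun z => (1, z⁻¹)) (by simp [mul_comm])
  b := MonoidHom.mk' (fun z => (1, z)) (by simp)
  c := MonoidHom.id _
  d := MonoidHom.mk' (fun r => (r.1, 1)) (by simp)
  comm_left := by simp [mul_comm]
  comm_right := by simp

/-- The `T × C`-set `C`, with trivial action of `T`. -/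
def GSet.trivialFibre [Finite C] : GSet (T × C) where
  carrier := C
  act := MulAction.compHom C (MonoidHom.snd T C)

theorem fib_assoc (X Y Z : GSet (T × C)) :
    ((fibData T C).prod ((fibData T C).prod X Y) Z).Iso
      ((fibData T C).prod X ((fibData T C).prod Y Z)) := by
  have one_smul' : ∀ (W : GSet (T × C)) (w : W.carrier), ((1 : T), (1 : C)) • w = w :=
    fun _ w => one_smul _ w
  refine AmalgData.assoc_iso _ _ _ _ ?_ ?_ ?_ ?_ ?_
  · intro s x y z
    rw [← AmalgData.pt_smul (fibData T C) s x, AmalgData.smul_pt]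
    simp [fibData, one_smul']
  · intro l x y z
    rw [← AmalgData.pt_smul (fibData T C) l x, AmalgData.smul_pt,
      ← AmalgData.pt_smul (fibData T C) l ((fibData T C).c _ • y)]
    simp [fibData, one_smul', ← mul_smul]
  · intro l x y z
    rw [← AmalgData.pt_smul (fibData T C) l _ z, AmalgData.smul_pt,
      ← AmalgData.pt_smul (fibData T C) l x]
    simp [fibData, one_smul', ← mul_smul]
  · intro s x y z
    rw [← AmalgData.pt_smul (fibData T C) s x y]
    simp [fibData, one_smul']
  · intro r x y z
    rw [AmalgData.smul_pt, AmalgData.smul_pt]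
    simp [fibData]

theorem trivialFibre_fib [Finite C] (X : GSet (T × C)) :
    ((fibData T C).prod (GSet.trivialFibre T C) X).Iso X := by
  refine (fibData T C).iso_of (fun (z : C) x => ((1 : T), z) • x) ?_ ?_ ?_ ?_
  · intro s (z : C) x
    change ((1 : T), (s⁻¹ * z : C)) • ((1 : T), s) • x = _
    rw [← mul_smul]
    simp [mul_comm]
  · intro (z : C) x (z' : C) x' h
    change ((1 : T), z) • x = ((1 : T), z') • x' at h
    refine ⟨z * z'⁻¹, ?_, ?_⟩
    · change (z * z'⁻¹)⁻¹ * z = z'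
      simp
    · change ((1 : T), z * z'⁻¹) • x = x'
      rw [eq_comm, ← eq_inv_smul_iff, eq_comm] at h
      rw [← h, ← mul_smul]
      simp [mul_comm]
  · intro x
    exact ⟨(1 : C), x, one_smul _ x⟩
  · intro r (z : C) x
    change ((1 : T), (r.2 * z : C)) • (r.1, (1 : C)) • x = r • ((1 : T), z) • x
    rw [← mul_smul, ← mul_smul]
    congr 1
    ext <;> simp

theorem fib_comm (X Y : GSet (T × C)) :
    ((fibData T C).prod X Y).Iso ((fibData T C).prod Y X) := by
  refine (fibData T C).iso_of (fun x y => (fibData T C).pt y x) ?_ ?_ ?_ ?_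
  · intro s x y
    rw [← (fibData T C).pt_smul s]
    have one_smul' : ∀ (W : GSet (T × C)) (w : W.carrier), ((1 : T), (1 : C)) • w = w :=
      fun _ w => one_smul _ w
    simp [fibData, ← mul_smul, one_smul']
  · intro x y x' y' h
    obtain ⟨s, h1, h2⟩ := ((fibData T C).pt_eq_iff).1 h
    refine ⟨s⁻¹, ?_, ?_⟩
    · rw [← h2]
      simp [fibData]
    · rw [← h1]
      simp [fibData]
  · refine (fibData T C).ind fun y x => ⟨x, y, rfl⟩
  · intro r x y
    rw [(fibData T C).smul_pt, ← (fibData T C).pt_smul r.2⁻¹]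
    obtain ⟨t, z⟩ := r
    simp [fibData, ← mul_smul]

/-- The Burnside group `B(T × C)` with the product `×_C`. -/
def FibB : Type (u + 1) := BurnsideGroup (T × C)

instance : AddCommGroup (FibB T C) :=
  inferInstanceAs (AddCommGroup (BurnsideGroup (T × C)))

instance FibB.ring [Finite C] : Ring (FibB T C) where
  __ := (inferInstance : AddCommGroup (FibB T C))
  mul x y := (fibData T C).bprod x y
  one := BurnsideGroup.cls (GSet.trivialFibre T C)
  left_distrib x y z := map_add ((fibData T C).bprod x) y z
  right_distrib x y z := DFunLike.congr_fun (map_add (fibData T C).bprod x y) z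
  zero_mul x := DFunLike.congr_fun (map_zero (fibData T C).bprod) x
  mul_zero x := map_zero ((fibData T C).bprod x)
  mul_assoc := AmalgData.bprod_assoc _ _ _ _ (fib_assoc T C)
  one_mul := AmalgData.bprod_left_unit _ _ (trivialFibre_fib T C)
  mul_one := AmalgData.bprod_right_unit _ _ fun X =>
    (fib_comm T C _ _).trans (trivialFibre_fib T C X)

variable {T C}

/-- A `T × C`-set is `C`-free, that is, a `C`-fibred `T`-set. -/
def GSet.IsFibred (X : GSet (T × C)) : Prop :=
  ∀ (z : C) (x : X.carrier), ((1 : T), z) • x = x → z = 1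

theorem isFibred_trivialFibre [Finite C] : (GSet.trivialFibre T C).IsFibred := by
  intro z (x : C) h
  change z * x = x at h
  simpa using h

theorem GSet.IsFibred.prod {X Y : GSet (T × C)} (hX : X.IsFibred) (hY : Y.IsFibred) :
    ((fibData T C).prod X Y).IsFibred := by
  intro z
  refine (fibData T C).ind fun x y h => ?_
  rw [(fibData T C).smul_pt] at h
  obtain ⟨s, h1, h2⟩ := ((fibData T C).pt_eq_iff).1 h
  have h3 : s = 1 := by
    refine hY s y ?_
    convert! h2 using 1
    simp [fibData, ← mul_smul]
  subst h3
  exact hX z x (by rwa [map_one, one_smul] at h1)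

/-- The twist `τ(U)` of a `T × C`-set `U` by an automorphism `τ` of `C`: the set `U` with the
action `(t, z) · u = (t, τ⁻¹ z) • u`. -/
def GSet.twist (τ : MulAut C) (U : GSet (T × C)) : GSet (T × C) :=
  U.res ((MonoidHom.id T).prodMap (τ⁻¹ : MulAut C).toMonoidHom)

theorem GSet.IsFibred.twist (τ : MulAut C) {U : GSet (T × C)} (hU : U.IsFibred) :
    (U.twist τ).IsFibred := by
  intro z (u : U.carrier) h
  change ((1 : T), τ⁻¹ z) • u = u at h
  simpa using hU _ u h

theorem twist_prod (τ : MulAut C) (X Y : GSet (T × C)) :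
    ((fibData T C).prod (X.twist τ) (Y.twist τ)).Iso (((fibData T C).prod X Y).twist τ) := by
  refine (fibData T C).iso_of
    (fun (x : X.carrier) (y : Y.carrier) => (fibData T C).pt x y) ?_ ?_ ?_ ?_
  · intro s (x : X.carrier) (y : Y.carrier)
    refine Eq.trans ?_ ((fibData T C).pt_smul (τ⁻¹ s) x y)
    change (fibData T C).pt (((1 : T), τ⁻¹ s⁻¹) • x) (((1 : T), τ⁻¹ s) • y) = _
    rw [map_inv]
    rfl
  · intro (x : X.carrier) (y : Y.carrier) (x' : X.carrier) (y' : Y.carrier) h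
    obtain ⟨s, h1, h2⟩ := ((fibData T C).pt_eq_iff).1 h
    refine ⟨τ s, ?_, ?_⟩
    · rw [← h1]
      change ((1 : T), τ⁻¹ (τ s)⁻¹) • x = ((1 : T), s⁻¹) • x
      simp
    · rw [← h2]
      change ((1 : T), τ⁻¹ (τ s)) • y = ((1 : T), s) • y
      simp
  · exact (fibData T C).ind fun x y => ⟨x, y, rfl⟩
  · intro r (x : X.carrier) (y : Y.carrier)
    change (fibData T C).pt ((r.1, τ⁻¹ r.2) • x) ((r.1, τ⁻¹ 1) • y) =
      (fibData T C).pt ((r.1, τ⁻¹ r.2) • x) ((r.1, (1 : C)) • y)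
    rw [map_one]

theorem twist_trivialFibre [Finite C] (τ : MulAut C) :
    ((GSet.trivialFibre T C).twist τ).Iso (GSet.trivialFibre T C) := by
  refine ⟨(τ : C ≃* C).toEquiv, fun r (z : C) => ?_⟩
  change τ (τ⁻¹ r.2 * z) = r.2 * τ z
  simp

theorem twist_iso (τ : MulAut C) {X Y : GSet (T × C)} (h : X.Iso Y) :
    (X.twist τ).Iso (Y.twist τ) := by
  obtain ⟨e, he⟩ := h
  exact ⟨e, fun r x => he _ x⟩

/-- The action `[U] ↦ [τ(U)]` of an automorphism `τ` of `C` on `B(T × C)`. -/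
def twistB (τ : MulAut C) : BurnsideGroup (T × C) →+ BurnsideGroup (T × C) :=
  BurnsideGroup.lift ((BurnsideGroup.of _).comp
    { toFun := Quotient.map (GSet.twist τ) fun _ _ h => twist_iso τ h
      map_zero' := Quotient.sound ⟨Equiv.refl _, fun _ x => x.elim⟩
      map_add' := by
        rintro ⟨X⟩ ⟨Y⟩
        refine Quotient.sound ⟨Equiv.refl _, ?_⟩
        rintro r (x | x) <;> rfl })

theorem twistB_cls (τ : MulAut C) (X : GSet (T × C)) :
    twistB τ (BurnsideGroup.cls X) = BurnsideGroup.cls (X.twist τ) :=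
  BurnsideGroup.lift_of _ _

theorem twistB_bprod (τ : MulAut C) (x y : BurnsideGroup (T × C)) :
    twistB τ ((fibData T C).bprod x y) = (fibData T C).bprod (twistB τ x) (twistB τ y) := by
  induction x using BurnsideGroup.ind with
  | hadd a b ha hb => simp only [map_add, AddMonoidHom.add_apply, ha, hb]
  | hneg a ha => simp only [map_neg, AddMonoidHom.neg_apply, ha]
  | hcls X =>
  induction y using BurnsideGroup.ind with
  | hadd a b ha hb => simp only [map_add, ha, hb]
  | hneg a ha => simp only [map_neg, ha]
  | hcls Y =>
    simp only [AmalgData.bprod_cls, twistB_cls]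
    exact (BurnsideGroup.cls_eq (twist_prod τ X Y)).symm

variable (T C)

/-- The identity map from `B(T × C)` to `B(T × C)` with the product `×_C`. -/
def FibB.of : BurnsideGroup (T × C) ≃+ FibB T C := AddEquiv.refl _

variable (k : Type v) [CommRing k] [Finite C]

/-- `kB(T × C) = k ⊗ B(T × C)` with the product `×_C`. -/
abbrev KFibB : Type (max v (u + 1)) := k ⊗[ℤ] FibB T C

variable {T C}

/-- The class `[X]` of a `T × C`-set in `kB(T × C)`. -/
def fibCls (X : GSet (T × C)) : KFibB T C k := (1 : k) ⊗ₜ[ℤ] FibB.of T C (BurnsideGroup.cls X)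

theorem fibCls_mul (X Y : GSet (T × C)) :
    fibCls k X * fibCls k Y = fibCls k ((fibData T C).prod X Y) := by
  simp only [fibCls, Algebra.TensorProduct.tmul_mul_tmul, mul_one]
  rw [← AmalgData.bprod_cls]
  rfl

variable (T C)

/-- The monomial Burnside ring `kB^C(T)` as a subalgebra: the submodule of `kB(T × C)` generated by the classes
of the `C`-fibred `T`-sets, with the product `×_C`. -/
def monomialSubalgebra : Subalgebra k (KFibB T C k) :=
  (Submodule.span k {x | ∃ X : GSet (T × C), X.IsFibred ∧ x = fibCls k X}).toSubalgebra
    (Submodule.subset_span ⟨_, isFibred_trivialFibre, rfl⟩) (by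
      intro x y hx hy
      induction hx, hy using Submodule.span_induction₂ with
      | mem_mem x y hx hy =>
        obtain ⟨X, hX, rfl⟩ := hx
        obtain ⟨Y, hY, rfl⟩ := hy
        exact Submodule.subset_span ⟨_, hX.prod hY, fibCls_mul k X Y⟩
      | zero_left y hy => rw [zero_mul]; exact Submodule.zero_mem _
      | zero_right x hx => rw [mul_zero]; exact Submodule.zero_mem _
      | add_left x y z _ _ _ h1 h2 => rw [add_mul]; exact Submodule.add_mem _ h1 h2
      | add_right x y z _ _ _ h1 h2 => rw [mul_add]; exact Submodule.add_mem _ h1 h2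
      | smul_left r x y _ _ h => rw [smul_mul_assoc]; exact Submodule.smul_mem _ _ h
      | smul_right r x y _ _ h => rw [mul_smul_comm]; exact Submodule.smul_mem _ _ h)

variable {T C}

/-- The action of an automorphism of `C` on `B(T × C)` as a ring homomorphism. -/
def twistRingHom (τ : MulAut C) : FibB T C →+* FibB T C where
  toFun x := FibB.of T C (twistB τ ((FibB.of T C).symm x))
  map_zero' := by simp
  map_add' := by simp
  map_one' := (twistB_cls τ _).trans (BurnsideGroup.cls_eq (twist_trivialFibre τ))
  map_mul' := twistB_bprod τ

/-- The action of an automorphism of `C` on `kB(T × C)`. -/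
def twistAlgHom (τ : MulAut C) : KFibB T C k →ₐ[k] KFibB T C k :=
  Algebra.TensorProduct.map (AlgHom.id k k) (twistRingHom τ).toIntAlgHom

theorem twistAlgHom_fibCls (τ : MulAut C) (X : GSet (T × C)) :
    twistAlgHom k τ (fibCls k X) = fibCls k (X.twist τ) := by
  refine (Algebra.TensorProduct.map_tmul _ _ _ _).trans ?_
  exact congrArg (fun z => (1 : k) ⊗ₜ[ℤ] FibB.of T C z) (twistB_cls τ X)

theorem twistAlgHom_mem (τ : MulAut C) {x : KFibB T C k} (hx : x ∈ monomialSubalgebra T C k) :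
    twistAlgHom k τ x ∈ monomialSubalgebra T C k := by
  change x ∈ Submodule.span k _ at hx
  change _ ∈ Submodule.span k _
  induction hx using Submodule.span_induction with
  | mem x hx =>
    obtain ⟨X, hX, rfl⟩ := hx
    exact Submodule.subset_span ⟨_, hX.twist τ, twistAlgHom_fibCls k τ X⟩
  | zero => rw [map_zero]; exact Submodule.zero_mem _
  | add x y _ _ h1 h2 => rw [map_add]; exact Submodule.add_mem _ h1 h2
  | smul r x _ h => rw [map_smul]; exact Submodule.smul_mem _ _ h

theorem monomial_ext {f g : KFibB T C k →ₐ[k] KFibB T C k}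
    (h : ∀ X : GSet (T × C), f (fibCls k X) = g (fibCls k X)) : f = g := by
  apply AlgHom.toLinearMap_injective
  apply TensorProduct.AlgebraTensorModule.curry_injective
  ext x
  induction x using BurnsideGroup.ind (G := T × C) with
  | hadd a b ha hb =>
    exact (map_add _ a b).trans ((congrArg₂ _ ha hb).trans (map_add _ a b).symm)
  | hneg a ha =>
    exact (map_neg _ a).trans ((congrArg _ ha).trans (map_neg _ a).symm)
  | hcls X => exact h X

theorem twistAlgHom_one : twistAlgHom (T := T) (C := C) k 1 = AlgHom.id k _ :=
  monomial_ext k fun X => by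
    rw [twistAlgHom_fibCls]
    exact congrArg (fun z => (1 : k) ⊗ₜ[ℤ] FibB.of T C z)
      (BurnsideGroup.cls_eq ⟨Equiv.refl _, fun _ _ => rfl⟩)

theorem twistAlgHom_mul (σ τ : MulAut C) :
    twistAlgHom (T := T) k (σ * τ) = (twistAlgHom k σ).comp (twistAlgHom k τ) :=
  monomial_ext k fun X => by
    rw [AlgHom.comp_apply, twistAlgHom_fibCls, twistAlgHom_fibCls, twistAlgHom_fibCls]
    exact congrArg (fun z => (1 : k) ⊗ₜ[ℤ] FibB.of T C z)
      (BurnsideGroup.cls_eq ⟨Equiv.refl _, fun r x => by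
        change (r.1, (σ * τ)⁻¹ r.2) • (show X.carrier from x) =
          (r.1, τ⁻¹ (σ⁻¹ r.2)) • (show X.carrier from x)
        rw [mul_inv_rev]
        rfl⟩)

/-- The monomial Burnside ring `kB^C(T)`. -/
def MonomialBurnside (T C : Type u) [Group T] [CommGroup C] (k : Type v) [CommRing k]
    [Finite C] : Type (max v (u + 1)) := ↥(monomialSubalgebra T C k)

instance MonomialBurnside.ring : Ring (MonomialBurnside T C k) :=
  inferInstanceAs (Ring (monomialSubalgebra T C k))

instance MonomialBurnside.algebra : Algebra k (MonomialBurnside T C k) :=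
  inferInstanceAs (Algebra k (monomialSubalgebra T C k))

/-- The inclusion of `kB^C(T)` in `kB(T × C)`. -/
def MonomialBurnside.incl : MonomialBurnside T C k →ₐ[k] KFibB T C k :=
  (monomialSubalgebra T C k).val

theorem MonomialBurnside.incl_injective :
    Function.Injective (MonomialBurnside.incl (T := T) (C := C) k) :=
  Subtype.val_injective

/-- The action of the automorphisms of `C` on `kB^C(T)`, by `τ • [U] = [τ(U)]`. -/
instance MonomialBurnside.mulAutAction : MulSemiringAction (MulAut C) (MonomialBurnside T C k) where
  smul τ x := ⟨twistAlgHom k τ (MonomialBurnside.incl k x), twistAlgHom_mem k τ x.2⟩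
  one_smul x := MonomialBurnside.incl_injective k (by
    change twistAlgHom k 1 (MonomialBurnside.incl k x) = MonomialBurnside.incl k x
    rw [twistAlgHom_one]
    rfl)
  mul_smul σ τ x := MonomialBurnside.incl_injective k (by
    change twistAlgHom k (σ * τ) (MonomialBurnside.incl k x) =
      twistAlgHom k σ (twistAlgHom k τ (MonomialBurnside.incl k x))
    rw [twistAlgHom_mul]
    rfl)
  smul_zero τ := MonomialBurnside.incl_injective k (map_zero (twistAlgHom k τ))
  smul_add τ x y := MonomialBurnside.incl_injective k
    (map_add (twistAlgHom k τ) (MonomialBurnside.incl k x) (MonomialBurnside.incl k y))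
  smul_one τ := MonomialBurnside.incl_injective k (map_one (twistAlgHom k τ))
  smul_mul τ x y := MonomialBurnside.incl_injective k
    (map_mul (twistAlgHom k τ) (MonomialBurnside.incl k x) (MonomialBurnside.incl k y))

theorem MonomialBurnside.incl_smul (τ : MulAut C) (x : MonomialBurnside T C k) :
    MonomialBurnside.incl k (τ • x) = twistAlgHom k τ (MonomialBurnside.incl k x) := rfl

end Monomial

/-! ### The algebra `kB^{Z(G)}(T) ⋊ Out(G)` -/

section Semidirect

variable (G : Type u) [Group G]

/-- The center of a group is an abelian group. -/
instance centerCommGroup : CommGroup (Subgroup.center G) where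
  __ := (inferInstance : Group (Subgroup.center G))
  mul_comm a b := Subtype.ext (Subgroup.mem_center_iff.1 b.2 a)

instance conj_range_normal : (MulAut.conj : G →* MulAut G).range.Normal where
  conj_mem := by
    rintro _ ⟨g, rfl⟩ σ
    refine ⟨σ g, ?_⟩
    ext x
    simp [MulAut.conj_apply]

/-- The outer automorphism group `Out(G) = Aut(G) / Inn(G)`. -/
abbrev Out : Type u := MulAut G ⧸ (MulAut.conj : G →* MulAut G).range

/-- The action of `Out(G)` on `Z(G)` by restriction of automorphisms. -/
def outCenter : Out G →* MulAut (Subgroup.center G) :=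
  QuotientGroup.lift _ (MulAut.characteristic (Subgroup.center G)) (by
    rintro _ ⟨g, rfl⟩
    ext z
    have := Subgroup.mem_center_iff.1 z.2 g
    change g * (z : G) * g⁻¹ = z
    rw [this, mul_inv_cancel_right])

variable (k : Type v) [CommRing k] [Finite G] (T : Type u) [Group T]

/-- The action of `Out(G)` on `kB^{Z(G)}(T)`. -/
instance MonomialBurnside.outAction :
    MulSemiringAction (Out G) (MonomialBurnside T (Subgroup.center G) k) :=
  MulSemiringAction.compHom _ (outCenter G)

instance MonomialBurnside.smulCommClass :
    SMulCommClass (Out G) k (MonomialBurnside T (Subgroup.center G) k) where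
  smul_comm σ r x := MonomialBurnside.incl_injective k
    (map_smul (twistAlgHom k (outCenter G σ)) r (MonomialBurnside.incl k x))

/-- The algebra `kB^{Z(G)}(T) ⋊ Out(G)`: the direct sum of copies of `kB^{Z(G)}(T)` indexed
by `Out(G)`, with the product `v_τ * u_σ = (v * τ(u))_{τσ}`. -/
abbrev SemidirectOut : Type (max v (u + 1)) :=
  SkewMonoidAlgebra (MonomialBurnside T (Subgroup.center G) k) (Out G)

/-- The product of `kB^{Z(G)}(T) ⋊ Out(G)`. -/
theorem semidirectOut_mul (τ σ : Out G) (v u : MonomialBurnside T (Subgroup.center G) k) :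
    (SkewMonoidAlgebra.single τ v * SkewMonoidAlgebra.single σ u : SemidirectOut G k T) =
      SkewMonoidAlgebra.single (τ * σ) (v * τ • u) :=
  SkewMonoidAlgebra.single_mul_single

end Semidirect

end
end ShiftedBurnside

open ShiftedBurnside

/-!
# The essential algebra of the shifted Burnside category for coprime orders

The stabilizers of the points of a composite `X ×_K^d Y` are exactly the products `S ∗ S'` of
stabilizers of points of `X` and of `Y` (`stabilizer_pt`). Hence the classes of the sets all of
whose stabilizers are star-decomposable span a two-sided ideal, and this ideal contains `I_T(G)`
(`factorIdeal_le`). So every additive invariant of `G × G × T`-sets that only sees points with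
indecomposable stabilizer vanishes on `I_T(G)`. Two such invariants are used: the number of orbits
isomorphic to `(G × G × T) / D`, for `D` indecomposable, which separates the elements of `𝓛_{s'}`
(`setLs_linearIndependent`), and the `T × Z(G)`-set of the points whose stabilizer in `G × G` is the
graph of a given automorphism (`graphFixK_eq_zero`).

In the other direction, a subgroup `D` factors through its left section `p₁(D) / k₁(D)`, and the
corresponding composite of transitive sets is again transitive (`section_comp_iso`). If the section
is smaller than `G`, then `D` is decomposable and its class lies in `I_T(G)`. If it is not, then
coprimality of `|G|` and `|T|` forces `D = D_{σ, 1, T₀}` (`eq_directSubgroup_of_card_not_lt`). A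
pigeonhole argument (`not_starDecomposable`) shows that the subgroups `D_{σ, α, T₀}`, and those
defining `𝓖`, are indecomposable. This identifies the three sets and shows that they span.

The isomorphism comes from `u_σ ↦ G ×_{Z(G)} U`, with `G × G` acting on `G`
by `(a, b) • x = a x σ(b)⁻¹`. Already before passing to the quotient, this is multiplicative, by
`([x, v], [y, u]) ↦ [x τ(y), [v, u]]` (`twisted_comp_iso`), and it depends only on the class of `σ`
in `Out(G)`, so it gives an algebra homomorphism into `kB_T(G × G)` (`semidirectHom`). The points
of `G ×_{Z(G)} U` whose stabilizer in `G × G` is the graph of `σ` form a copy of `U`, and there are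
no such points for automorphisms of another class, so the composite with the projection to the
essential algebra is injective. It is surjective since `D_{σ, 1, T₀}` is the stabilizer of a point
of a transitive set of the form `G ×_{Z(G)} U` (`twisted_coset_iso`). Finally `semidirectHom` splits
the projection of `kB_T(G × G)` onto the essential algebra, which gives the direct sum decomposition.
-/

namespace ShiftedBurnside

noncomputable section

/-! ### Finite `G`-sets: orbits and additive invariants -/

section GSets

variable {G : Type u} [Group G]

/-- The sub-`G`-set of the points satisfying an invariant predicate. -/
def GSet.sub (X : GSet G) (p : X.carrier → Prop) (hp : ∀ (g : G) x, p x → p (g • x)) : GSet G where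
  carrier := {x // p x}
  act :=
    { smul := fun g x => ⟨g • x.1, hp g x.1 x.2⟩
      one_smul := fun x => Subtype.ext (one_smul G x.1)
      mul_smul := fun g h x => Subtype.ext (mul_smul g h x.1) }

theorem cls_sum (X Y : GSet G) :
    BurnsideGroup.cls (X.sum Y) = BurnsideGroup.cls X + BurnsideGroup.cls Y :=
  map_add (BurnsideGroup.of G) (IsoClass.mk X) (IsoClass.mk Y)

theorem GSet.iso_sub_sum_sub (X : GSet G) (p : X.carrier → Prop)
    (hp : ∀ (g : G) x, p x → p (g • x)) (hn : ∀ (g : G) x, ¬ p x → ¬ p (g • x)) :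
    ((X.sub p hp).sum (X.sub (fun x => ¬ p x) hn)).Iso X := by
  classical
  refine ⟨Equiv.sumCompl p, ?_⟩
  rintro g (x | x) <;> rfl

/-- A transitive `G`-set is isomorphic to the cosets of the stabilizer of any of its points. -/
theorem GSet.iso_coset [Finite G] (X : GSet G) (x : X.carrier) (h : ∀ y, ∃ g : G, g • x = y) :
    X.Iso (GSet.coset (MulAction.stabilizer G x)) := by
  refine GSet.Iso.symm ⟨Equiv.ofBijective (MulAction.ofQuotientStabilizer G x)
    ⟨MulAction.injective_ofQuotientStabilizer G x, fun y => ?_⟩,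
    MulAction.ofQuotientStabilizer_smul G x⟩
  obtain ⟨g, rfl⟩ := h y
  exact ⟨(g : G ⧸ MulAction.stabilizer G x), rfl⟩

/-- A subgroup of the Burnside group that contains the classes of all orbits of `X` contains the
class of `X`. -/
theorem cls_mem_of_orbits [Finite G] (S : AddSubgroup (BurnsideGroup G)) (X : GSet G)
    (h : ∀ x : X.carrier,
      BurnsideGroup.cls (GSet.coset (MulAction.stabilizer G x)) ∈ S) :
    BurnsideGroup.cls X ∈ S := by
  induction hn : Nat.card X.carrier using Nat.strong_induction_on generalizing X with
  | _ n ih =>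
  rcases isEmpty_or_nonempty X.carrier with he | ⟨⟨x⟩⟩
  · have h0 : X.Iso (GSet.empty G) := ⟨(Equiv.equivOfIsEmpty _ PEmpty), fun _ x => he.elim x⟩
    rw [BurnsideGroup.cls_eq h0]
    have h1 : BurnsideGroup.cls (GSet.empty G) = 0 := map_zero (BurnsideGroup.of G)
    rw [h1]
    exact S.zero_mem
  · have hp : ∀ (g : G) y, y ∈ MulAction.orbit G x → g • y ∈ MulAction.orbit G x :=
      fun g y hy => MulAction.mem_orbit_of_mem_orbit g hy
    have hq : ∀ (g : G) y, ¬ y ∈ MulAction.orbit G x → ¬ g • y ∈ MulAction.orbit G x :=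
      fun g y hy hy' => hy (by simpa using MulAction.mem_orbit_of_mem_orbit g⁻¹ hy')
    rw [← BurnsideGroup.cls_eq (X.iso_sub_sum_sub _ hp hq), cls_sum]
    refine S.add_mem ?_ ?_
    · let x' : (X.sub (· ∈ MulAction.orbit G x) hp).carrier := ⟨x, MulAction.mem_orbit_self x⟩
      have hx : (X.sub _ hp).Iso (GSet.coset (MulAction.stabilizer G x')) := by
        refine GSet.iso_coset _ _ ?_
        rintro ⟨_, g, rfl⟩
        exact ⟨g, rfl⟩
      have hs : MulAction.stabilizer G x' = MulAction.stabilizer G x := by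
        ext g
        exact Subtype.ext_iff
      have := h x
      rw [← hs] at this
      exact (BurnsideGroup.cls_eq hx).symm ▸ this
    · refine ih _ ?_ _ ?_ rfl
      · rw [← hn]
        exact Finite.card_subtype_lt (p := fun y => ¬ y ∈ MulAction.orbit G x)
          (not_not.2 (MulAction.mem_orbit_self x))
      · intro y
        have hs : MulAction.stabilizer G y = MulAction.stabilizer G y.1 := by
          ext g
          exact Subtype.ext_iff
        rw [hs]
        exact h y.1

/-- The homomorphism from the Burnside group induced by an invariant of finite `G`-sets that is
additive for disjoint unions. -/
def BurnsideGroup.liftGSet {A : Type*} [AddCommGroup A] (f : GSet G → A)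
    (iso : ∀ X Y, X.Iso Y → f X = f Y) (add : ∀ X Y, f (X.sum Y) = f X + f Y) :
    BurnsideGroup G →+ A :=
  BurnsideGroup.lift (G := G)
    { toFun := Quotient.lift f iso
      map_zero' := by
        -- `∅ ⊔ ∅ ≅ ∅`, so the value at `∅` is idempotent for addition.
        have h : f (GSet.empty G) = f (GSet.empty G) + f (GSet.empty G) :=
          (iso _ _ ⟨(Equiv.emptySum PEmpty PEmpty).symm, fun _ (x : PEmpty) => x.elim⟩).trans (add _ _)
        exact left_eq_add.1 h
      map_add' := by
        rintro ⟨X⟩ ⟨Y⟩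
        exact add X Y }

theorem BurnsideGroup.liftGSet_cls {A : Type*} [AddCommGroup A] (f : GSet G → A)
    (iso : ∀ X Y, X.Iso Y → f X = f Y) (add : ∀ X Y, f (X.sum Y) = f X + f Y) (X : GSet G) :
    BurnsideGroup.liftGSet f iso add (BurnsideGroup.cls X) = f X :=
  BurnsideGroup.lift_of _ _

theorem cls_of_isEmpty (X : GSet G) [he : IsEmpty X.carrier] : BurnsideGroup.cls X = 0 :=
  (BurnsideGroup.cls_eq ⟨(Equiv.equivOfIsEmpty _ PEmpty), fun _ x => he.elim x⟩).trans
    (map_zero (BurnsideGroup.of G))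

/-- Two points of `X` with stabilizer `D` are equivalent if they lie in the same orbit. -/
def GSet.typeSetoid (D : Subgroup G) (X : GSet G) :
    Setoid {x : X.carrier // MulAction.stabilizer G x = D} :=
  (MulAction.orbitRel G X.carrier).comap Subtype.val

/-- The number of orbits of `X` that are isomorphic to `G / D`. -/
def GSet.orbitCount (D : Subgroup G) (X : GSet G) : ℕ := Nat.card (Quotient (X.typeSetoid D))

theorem GSet.orbitCount_eq_of_iso (D : Subgroup G) {X Y : GSet G} (h : X.Iso Y) :
    X.orbitCount D = Y.orbitCount D := by
  obtain ⟨e, he⟩ := h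
  have hs : ∀ x, MulAction.stabilizer G x = D ↔ MulAction.stabilizer G (e x) = D := by
    intro x
    have : MulAction.stabilizer G (e x) = MulAction.stabilizer G x := by
      ext g
      simp [MulAction.mem_stabilizer_iff, ← he]
    rw [this]
  refine Nat.card_congr (Quotient.congr (e.subtypeEquiv hs) ?_)
  rintro ⟨x, hx⟩ ⟨y, hy⟩
  change (∃ g : G, g • y = x) ↔ ∃ g : G, g • e y = e x
  simp [← he]

theorem GSet.orbitCount_sum (D : Subgroup G) (X Y : GSet G) :
    (X.sum Y).orbitCount D = X.orbitCount D + Y.orbitCount D := by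
  have hX : Finite (Quotient (X.typeSetoid D)) := Quotient.finite _
  have hY : Finite (Quotient (Y.typeSetoid D)) := Quotient.finite _
  have hl : ∀ x, MulAction.stabilizer G (show (X.sum Y).carrier from Sum.inl x) =
      MulAction.stabilizer G x := fun x => by
    ext g
    exact Sum.inl_injective.eq_iff (a := g • x) (b := x)
  have hr : ∀ x, MulAction.stabilizer G (show (X.sum Y).carrier from Sum.inr x) =
      MulAction.stabilizer G x := fun x => by
    ext g
    exact Sum.inr_injective.eq_iff (a := g • x) (b := x)
  unfold GSet.orbitCount
  rw [← Nat.card_sum]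
  symm
  refine Nat.card_eq_of_bijective (Sum.elim
    (Quotient.map (fun x => ⟨Sum.inl x.1, (hl x.1).trans x.2⟩) ?_)
    (Quotient.map (fun x => ⟨Sum.inr x.1, (hr x.1).trans x.2⟩) ?_)) ⟨?_, ?_⟩
  · rintro ⟨x, hx⟩ ⟨y, hy⟩ ⟨g, hg⟩
    exact ⟨g, congrArg Sum.inl hg⟩
  · rintro ⟨x, hx⟩ ⟨y, hy⟩ ⟨g, hg⟩
    exact ⟨g, congrArg Sum.inr hg⟩
  · rintro (⟨⟨x, hx⟩⟩ | ⟨⟨x, hx⟩⟩) (⟨⟨y, hy⟩⟩ | ⟨⟨y, hy⟩⟩) h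
    · obtain ⟨g, hg⟩ := Quotient.exact h
      exact congrArg Sum.inl (Quotient.sound ⟨g, Sum.inl_injective hg⟩)
    · obtain ⟨g, hg⟩ := Quotient.exact h
      exact (Sum.inr_ne_inl hg).elim
    · obtain ⟨g, hg⟩ := Quotient.exact h
      exact (Sum.inl_ne_inr hg).elim
    · obtain ⟨g, hg⟩ := Quotient.exact h
      exact congrArg Sum.inr (Quotient.sound ⟨g, Sum.inr_injective hg⟩)
  · rintro ⟨⟨x | x, hx⟩⟩
    · exact ⟨Sum.inl (Quotient.mk _ ⟨x, (hl x).symm.trans hx⟩), rfl⟩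
    · exact ⟨Sum.inr (Quotient.mk _ ⟨x, (hr x).symm.trans hx⟩), rfl⟩

/-- The additive extension of `GSet.orbitCount` to the Burnside group. -/
def orbitCountB (D : Subgroup G) : BurnsideGroup G →+ ℤ :=
  BurnsideGroup.liftGSet (fun X => (X.orbitCount D : ℤ))
    (fun _ _ h => congrArg _ (GSet.orbitCount_eq_of_iso D h))
    (fun X Y => by rw [GSet.orbitCount_sum]; push_cast; rfl)

theorem orbitCountB_cls (D : Subgroup G) (X : GSet G) :
    orbitCountB D (BurnsideGroup.cls X) = X.orbitCount D := BurnsideGroup.liftGSet_cls _ _ _ _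

theorem GSet.orbitCount_eq_zero {D : Subgroup G} {X : GSet G}
    (h : ∀ x : X.carrier, MulAction.stabilizer G x ≠ D) : X.orbitCount D = 0 := by
  have : IsEmpty (Quotient (X.typeSetoid D)) := ⟨by rintro ⟨x, hx⟩; exact h x hx⟩
  exact Nat.card_of_isEmpty

/-- The coset `D` as a point of `G / D`. -/
def GSet.cosetOne [Finite G] (D : Subgroup G) : (GSet.coset D).carrier := ((1 : G) : G ⧸ D)

theorem stabilizer_coset_one [Finite G] (D : Subgroup G) :
    MulAction.stabilizer G (GSet.cosetOne D) = D := by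
  ext g
  rw [MulAction.mem_stabilizer_iff]
  change (((g * 1 : G) : G ⧸ D) = ((1 : G) : G ⧸ D)) ↔ _
  rw [eq_comm, QuotientGroup.eq]
  simp

theorem coset_transitive [Finite G] (D : Subgroup G) (y : (GSet.coset D).carrier) :
    ∃ g : G, g • (GSet.cosetOne D) = y := by
  obtain ⟨g, rfl⟩ := QuotientGroup.mk_surjective (s := D) y
  exact ⟨g, congrArg (QuotientGroup.mk (s := D)) (mul_one g)⟩

theorem smul_cosetOne_eq_iff [Finite G] {D : Subgroup G} {a b : G} :
    a • GSet.cosetOne D = b • GSet.cosetOne D ↔ a⁻¹ * b ∈ D := by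
  refine (QuotientGroup.eq (s := D) (a := a * 1) (b := b * 1)).trans ?_
  rw [mul_one, mul_one]

theorem orbitCount_coset_self [Finite G] (D : Subgroup G) : (GSet.coset D).orbitCount D = 1 := by
  refine Nat.card_eq_one_iff_unique.2 ⟨⟨?_⟩, ⟨Quotient.mk _ ⟨_, stabilizer_coset_one D⟩⟩⟩
  rintro ⟨x, hx⟩ ⟨y, hy⟩
  obtain ⟨g, rfl⟩ := coset_transitive D x
  obtain ⟨h, rfl⟩ := coset_transitive D y
  exact Quotient.sound ⟨g * h⁻¹, by
    change (g * h⁻¹) • h • GSet.cosetOne D = g • GSet.cosetOne D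
    rw [smul_smul, inv_mul_cancel_right]⟩

/-- If `G / E` contains a point with stabilizer `D` then it is isomorphic to `G / D`. -/
theorem coset_iso_of_orbitCount_ne_zero [Finite G] {D E : Subgroup G}
    (h : (GSet.coset E).orbitCount D ≠ 0) : (GSet.coset E).Iso (GSet.coset D) := by
  by_contra hn
  refine h (GSet.orbitCount_eq_zero fun x hx => hn ?_)
  subst hx
  refine GSet.iso_coset _ x fun y => ?_
  obtain ⟨a, rfl⟩ := coset_transitive E x
  obtain ⟨b, rfl⟩ := coset_transitive E y
  exact ⟨b * a⁻¹, by rw [smul_smul, inv_mul_cancel_right]⟩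

end GSets

/-! ### Stabilizers in composites and the ideal of factorizable elements -/

section Decomposable

/-- The stabilizers of the composite `X ×_K^d Y` are exactly the products `S ∗ S'` of stabilizers
of `X` and `Y`. -/
theorem stabilizer_pt {H K L T : Type u} [Group H] [Group K] [Group L] [Group T]
    {X : GSet (H × K × T)} {Y : GSet (K × L × T)} (x : X.carrier) (y : Y.carrier) :
    MulAction.stabilizer (H × L × T) ((compData H K L T).pt x y) =
      starProd (MulAction.stabilizer (H × K × T) x) (MulAction.stabilizer (K × L × T) y) := by
  ext ⟨h, l, t⟩
  rw [MulAction.mem_stabilizer_iff, AmalgData.smul_pt, AmalgData.pt_eq_iff]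
  refine exists_congr fun s => ?_
  simp only [smul_smul]
  change _ ↔ (h, s, t) • x = x ∧ (s, l, t) • y = y
  simp [compData]

variable {G T : Type u} [Group G] [Group T]

theorem starProd_assoc {H K L M : Type u} [Group H] [Group K] [Group L] [Group M]
    (D : Subgroup (H × K × T)) (E : Subgroup (K × L × T)) (F : Subgroup (L × M × T)) :
    starProd (starProd D E) F = starProd D (starProd E F) := by
  ext ⟨h, m, t⟩
  constructor
  · rintro ⟨l, ⟨k, h1, h2⟩, h3⟩
    exact ⟨k, h1, l, h2, h3⟩
  · rintro ⟨k, h1, l, h2, h3⟩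
    exact ⟨l, ⟨k, h1, h2⟩, h3⟩

theorem StarDecomposable.starProd_left {D : Subgroup (G × G × T)} (hD : StarDecomposable D)
    (E : Subgroup (G × G × T)) : StarDecomposable (starProd E D) := by
  obtain ⟨H, _, _, hH, A, B, rfl⟩ := hD
  exact ⟨H, _, ‹_›, hH, starProd E A, B, (starProd_assoc _ _ _).symm⟩

theorem StarDecomposable.starProd_right {D : Subgroup (G × G × T)} (hD : StarDecomposable D)
    (E : Subgroup (G × G × T)) : StarDecomposable (starProd D E) := by
  obtain ⟨H, _, _, hH, A, B, rfl⟩ := hD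
  exact ⟨H, _, ‹_›, hH, A, starProd B E, starProd_assoc _ _ _⟩

/-- A subgroup containing the graph of an injective map `σ`, with no other elements `(a, g, 1)`,
is not decomposable: the elements `(σ g, g, 1)` would factor through `|G|` distinct elements of a
group of smaller order. -/
theorem not_starDecomposable [Finite G] {D : Subgroup (G × G × T)} (σ : G → G)
    (hσ : Function.Injective σ) (hD : ∀ g, (σ g, g, (1 : T)) ∈ D)
    (hD' : ∀ a g, (a, g, (1 : T)) ∈ D → a = σ g) : ¬ StarDecomposable D := by
  rintro ⟨H, _, _, hH, E, F, rfl⟩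
  -- `x g` is a middle element through which `(σ g, g, 1)` factors.
  choose x hx hx' using hD
  obtain ⟨g, g', he, hne⟩ := (Function.not_injective_iff (f := x)).1 fun hi =>
    hH.not_ge (Nat.card_le_card_of_injective x hi)
  refine hne (hσ (hD' (σ g) g' ⟨x g, hx g, ?_⟩))
  rw [he]
  exact hx' g'

/-- All stabilizers of points of `X` are decomposable. -/
def GSet.IsFactorable (X : GSet (G × G × T)) : Prop :=
  ∀ x : X.carrier, StarDecomposable (MulAction.stabilizer (G × G × T) x)

theorem GSet.IsFactorable.comp_left {X : GSet (G × G × T)} (hX : X.IsFactorable)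
    (W : GSet (G × G × T)) : ((compData G G G T).prod W X).IsFactorable := by
  refine (compData G G G T).ind fun w x => ?_
  rw [stabilizer_pt]
  exact (hX x).starProd_left _

theorem GSet.IsFactorable.comp_right {X : GSet (G × G × T)} (hX : X.IsFactorable)
    (W : GSet (G × G × T)) : ((compData G G G T).prod X W).IsFactorable := by
  refine (compData G G G T).ind fun x w => ?_
  rw [stabilizer_pt]
  exact (hX x).starProd_right _

theorem isFactorable_comp [Finite G] {K : Type u} [Group K] [Finite K]
    (hK : Nat.card K < Nat.card G) (X : GSet (G × K × T)) (Y : GSet (K × G × T)) :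
    ((compData G K G T).prod X Y).IsFactorable := by
  refine (compData G K G T).ind fun x y => ?_
  rw [stabilizer_pt]
  exact ⟨K, _, ‹_›, hK, _, _, rfl⟩

variable (k : Type v) [CommRing k] [Finite G]

/-- The class of a `G × G × T`-set in `kB_T(G × G)`. -/
def endCls (X : GSet (G × G × T)) : KEndB k G T :=
  (1 : k) ⊗ₜ[ℤ] EndB.of (BurnsideGroup.cls X)

theorem endCls_mul (X Y : GSet (G × G × T)) :
    endCls k X * endCls k Y = endCls k ((compData G G G T).prod X Y) := by
  simp only [endCls, Algebra.TensorProduct.tmul_mul_tmul, mul_one]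
  rw [← AmalgData.bprod_cls]
  rfl

theorem endCls_eq {X Y : GSet (G × G × T)} (h : X.Iso Y) : endCls k X = endCls k Y := by
  rw [endCls, BurnsideGroup.cls_eq h, endCls]

/-- A submodule of `k ⊗ B` containing the classes `1 ⊗ [X]` is everything. -/
theorem tmul_mem_of_cls {Γ : Type u} [Group Γ] (M : Submodule k (KBurnside k Γ))
    (h : ∀ X : GSet Γ, (1 : k) ⊗ₜ[ℤ] BurnsideGroup.cls X ∈ M) (x : KBurnside k Γ) : x ∈ M := by
  induction x using TensorProduct.induction_on with
  | zero => exact M.zero_mem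
  | add x y hx hy => exact M.add_mem hx hy
  | tmul r b =>
    have h1 : ∀ b : BurnsideGroup Γ, (1 : k) ⊗ₜ[ℤ] b ∈ M := fun b => by
      induction b using BurnsideGroup.ind with
      | hcls X => exact h X
      | hadd a b ha hb => rw [TensorProduct.tmul_add]; exact M.add_mem ha hb
      | hneg a ha => rw [TensorProduct.tmul_neg]; exact M.neg_mem ha
    have h2 := M.smul_mem r (h1 b)
    rwa [TensorProduct.smul_tmul', smul_eq_mul, mul_one] at h2

theorem span_endCls : Submodule.span k (Set.range (endCls k (G := G) (T := T))) = ⊤ := by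
  refine top_le_iff.1 fun x _ => ?_
  exact tmul_mem_of_cls (Γ := G × G × T) k (Submodule.span k (Set.range (endCls k)))
    (fun X => Submodule.subset_span ⟨X, rfl⟩) x

variable (G T) in
/-- The submodule of `kB_T(G × G)` spanned by the classes of the `G × G × T`-sets all of whose
stabilizers are decomposable. -/
def factorableSpan : Submodule k (KEndB k G T) :=
  Submodule.span k {x | ∃ X : GSet (G × G × T), X.IsFactorable ∧ x = endCls k X}

theorem mul_mem_factorableSpan (w : KEndB k G T) {x : KEndB k G T}
    (hx : x ∈ factorableSpan G T k) : w * x ∈ factorableSpan G T k := by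
  have hw : w ∈ Submodule.span k (Set.range (endCls k (G := G) (T := T))) :=
    span_endCls (G := G) (T := T) k ▸ Submodule.mem_top
  induction hw, hx using Submodule.span_induction₂ with
  | mem_mem w x hw hx =>
    obtain ⟨W, rfl⟩ := hw
    obtain ⟨X, hX, rfl⟩ := hx
    exact Submodule.subset_span ⟨_, hX.comp_left W, endCls_mul k W X⟩
  | zero_left y hy => rw [zero_mul]; exact Submodule.zero_mem _
  | zero_right x hx => rw [mul_zero]; exact Submodule.zero_mem _
  | add_left x y z _ _ _ h1 h2 => rw [add_mul]; exact Submodule.add_mem _ h1 h2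
  | add_right x y z _ _ _ h1 h2 => rw [mul_add]; exact Submodule.add_mem _ h1 h2
  | smul_left r x y _ _ h => rw [smul_mul_assoc]; exact Submodule.smul_mem _ _ h
  | smul_right r x y _ _ h => rw [mul_smul_comm]; exact Submodule.smul_mem _ _ h

theorem mem_factorableSpan_mul (w : KEndB k G T) {x : KEndB k G T}
    (hx : x ∈ factorableSpan G T k) : x * w ∈ factorableSpan G T k := by
  have hw : w ∈ Submodule.span k (Set.range (endCls k (G := G) (T := T))) :=
    span_endCls (G := G) (T := T) k ▸ Submodule.mem_top
  induction hx, hw using Submodule.span_induction₂ with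
  | mem_mem x w hx hw =>
    obtain ⟨W, rfl⟩ := hw
    obtain ⟨X, hX, rfl⟩ := hx
    exact Submodule.subset_span ⟨_, hX.comp_right W, endCls_mul k X W⟩
  | zero_left y hy => rw [zero_mul]; exact Submodule.zero_mem _
  | zero_right x hx => rw [mul_zero]; exact Submodule.zero_mem _
  | add_left x y z _ _ _ h1 h2 => rw [add_mul]; exact Submodule.add_mem _ h1 h2
  | add_right x y z _ _ _ h1 h2 => rw [mul_add]; exact Submodule.add_mem _ h1 h2
  | smul_left r x y _ _ h => rw [smul_mul_assoc]; exact Submodule.smul_mem _ _ h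
  | smul_right r x y _ _ h => rw [mul_smul_comm]; exact Submodule.smul_mem _ _ h

/-- The composition `kcomp` as a `k`-bilinear map. -/
def kcompLeft (K : Type u) [Group K] :
    KBurnside k (G × K × T) →ₗ[k] KBurnside k (K × G × T) →ₗ[k] KEndB k G T :=
  LinearMap.mk₂ k (kcomp k G K T)
    (fun x y z => by simp [kcomp])
    (fun r x y => by
      induction x using TensorProduct.induction_on with
      | zero => simp [kcomp]
      | add a b ha hb =>
        simp only [kcomp, smul_add, map_add, LinearMap.add_apply] at ha hb ⊢
        rw [ha, hb]
      | tmul s a =>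
        induction y using TensorProduct.induction_on with
        | zero => simp [kcomp]
        | add c d hc hd =>
          simp only [kcomp, smul_add, map_add] at hc hd ⊢
          rw [hc, hd]
        | tmul t b =>
          rw [TensorProduct.smul_tmul', kcomp_tmul, kcomp_tmul, TensorProduct.smul_tmul',
            smul_mul_assoc])
    (fun x y z => by simp [kcomp])
    (fun r x y => by
      induction y using TensorProduct.induction_on with
      | zero => simp [kcomp]
      | add a b ha hb =>
        simp only [kcomp, smul_add, map_add] at ha hb ⊢
        rw [ha, hb]
      | tmul t b =>
        induction x using TensorProduct.induction_on with
        | zero => simp [kcomp]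
        | add c d hc hd =>
          simp only [kcomp, smul_add, map_add, LinearMap.add_apply] at hc hd ⊢
          rw [hc, hd]
        | tmul s a =>
          rw [TensorProduct.smul_tmul', kcomp_tmul, kcomp_tmul, TensorProduct.smul_tmul',
            mul_smul_comm])

theorem kcomp_cls (K : Type u) [Group K] (X : GSet (G × K × T)) (Y : GSet (K × G × T)) :
    kcomp k G K T (1 ⊗ₜ BurnsideGroup.cls X) (1 ⊗ₜ BurnsideGroup.cls Y) =
      endCls k ((compData G K G T).prod X Y) := by
  rw [kcomp_tmul, AmalgData.bprod_cls, mul_one, endCls]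

theorem kcomp_mem_factorableSpan {K : Type u} [Group K] [Finite K]
    (hK : Nat.card K < Nat.card G) (α : KBurnside k (G × K × T)) (β : KBurnside k (K × G × T)) :
    kcomp k G K T α β ∈ factorableSpan G T k := by
  refine tmul_mem_of_cls k ((factorableSpan G T k).comap ((kcompLeft k K).flip β)) (fun X => ?_) α
  refine tmul_mem_of_cls k ((factorableSpan G T k).comap (kcompLeft k K _)) (fun Y => ?_) β
  exact Submodule.subset_span ⟨_, isFactorable_comp hK X Y, kcomp_cls k K X Y⟩

/-- The elements of the ideal `I_T(G)` are combinations of classes of sets with decomposable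
stabilizers. -/
theorem factorIdeal_le {x : KEndB k G T} (hx : x ∈ factorIdeal k G T) :
    x ∈ factorableSpan G T k := by
  let J : TwoSidedIdeal (KEndB k G T) :=
    .mk' (factorableSpan G T k) (Submodule.zero_mem _) (Submodule.add_mem _)
      (Submodule.neg_mem _) (mul_mem_factorableSpan k _) (mem_factorableSpan_mul k _)
  have hJ : ∀ y, y ∈ J ↔ y ∈ factorableSpan G T k := fun y => TwoSidedIdeal.mem_mk' _ _ _ _ _ _ y
  rw [← hJ]
  refine TwoSidedIdeal.span_le.2 ?_ (TwoSidedIdeal.mem_asIdeal.1 hx)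
  rintro _ ⟨K, _, _, hK, α, β, rfl⟩
  exact (hJ _).2 (kcomp_mem_factorableSpan k hK α β)

end Decomposable

/-! ### Factorization through the left section of a subgroup -/

section Factor

variable {G T : Type u} [Group G] [Group T]

/-- The first projection `p₁(D)` of `D ≤ G × G × T`. -/
def leftProj (D : Subgroup (G × G × T)) : Subgroup G := D.map (MonoidHom.fst G (G × T))

/-- The subgroup `k₁(D)` of the `g` with `(g, 1, 1) ∈ D`. -/
def leftKer (D : Subgroup (G × G × T)) : Subgroup G := D.comap (MonoidHom.inl G (G × T))

theorem mem_leftProj {D : Subgroup (G × G × T)} {g : G} :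
    g ∈ leftProj D ↔ ∃ l t, (g, l, t) ∈ D := by
  constructor
  · rintro ⟨⟨a, l, t⟩, h, rfl⟩
    exact ⟨l, t, h⟩
  · rintro ⟨l, t, h⟩
    exact ⟨_, h, rfl⟩

theorem mem_leftKer {D : Subgroup (G × G × T)} {g : G} :
    g ∈ leftKer D ↔ (g, (1 : G), (1 : T)) ∈ D := Iff.rfl

theorem leftKer_le (D : Subgroup (G × G × T)) : leftKer D ≤ leftProj D :=
  fun _ h => mem_leftProj.2 ⟨1, 1, h⟩

instance leftKer_normal (D : Subgroup (G × G × T)) :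
    ((leftKer D).subgroupOf (leftProj D)).Normal where
  conj_mem := by
    rintro ⟨n, _⟩ hn ⟨g, hg⟩
    obtain ⟨l, t, h⟩ := mem_leftProj.1 hg
    have h1 := D.mul_mem (D.mul_mem h (mem_leftKer.1 (Subgroup.mem_subgroupOf.1 hn)))
      (D.inv_mem h)
    refine Subgroup.mem_subgroupOf.2 (mem_leftKer.2 ?_)
    simpa using h1

/-- The left section `p₁(D) / k₁(D)`. -/
abbrev LeftSection (D : Subgroup (G × G × T)) : Type u :=
  leftProj D ⧸ (leftKer D).subgroupOf (leftProj D)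

/-- The subgroup `{(g, g k₁(D), t)}` of `G × (p₁(D) / k₁(D)) × T`. -/
def sectionLeft (D : Subgroup (G × G × T)) : Subgroup (G × LeftSection D × T) where
  carrier := {p | ∃ h : p.1 ∈ leftProj D, QuotientGroup.mk ⟨p.1, h⟩ = p.2.1}
  one_mem' := ⟨one_mem _, rfl⟩
  mul_mem' := by
    rintro ⟨a, q, t⟩ ⟨b, r, s⟩ ⟨h, e⟩ ⟨h', e'⟩
    exact ⟨mul_mem h h', congrArg₂ (· * ·) e e'⟩
  inv_mem' := by
    rintro ⟨a, q, t⟩ ⟨h, e⟩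
    exact ⟨inv_mem h, congrArg (·⁻¹) e⟩

/-- The subgroup `{(g k₁(D), l, t) | (g, l, t) ∈ D}` of `(p₁(D) / k₁(D)) × G × T`. -/
def sectionRight (D : Subgroup (G × G × T)) : Subgroup (LeftSection D × G × T) where
  carrier := {p | ∃ g : leftProj D, QuotientGroup.mk g = p.1 ∧ ((g : G), p.2.1, p.2.2) ∈ D}
  one_mem' := ⟨1, rfl, D.one_mem⟩
  mul_mem' := by
    rintro ⟨q, a, t⟩ ⟨r, b, s⟩ ⟨g, rfl, h⟩ ⟨g', rfl, h'⟩
    exact ⟨g * g', rfl, D.mul_mem h h'⟩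
  inv_mem' := by
    rintro ⟨q, a, t⟩ ⟨g, rfl, h⟩
    exact ⟨g⁻¹, rfl, D.inv_mem h⟩

theorem starProd_section (D : Subgroup (G × G × T)) :
    starProd (sectionLeft D) (sectionRight D) = D := by
  ext ⟨g, l, t⟩
  constructor
  · rintro ⟨q, ⟨hg, hq⟩, g', hq', h⟩
    have h1 := mem_leftKer.1 (Subgroup.mem_subgroupOf.1 (QuotientGroup.eq.1 (hq'.trans hq.symm)))
    simpa using D.mul_mem h h1
  · intro h
    have hg : g ∈ leftProj D := mem_leftProj.2 ⟨l, t, h⟩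
    exact ⟨QuotientGroup.mk ⟨g, hg⟩, ⟨hg, rfl⟩, ⟨g, hg⟩, rfl, h⟩

variable [Finite G]

theorem starDecomposable_of_card_lt {D : Subgroup (G × G × T)}
    (h : Nat.card (LeftSection D) < Nat.card G) : StarDecomposable D :=
  ⟨LeftSection D, inferInstance, inferInstance, h, _, _, (starProd_section D).symm⟩

variable [Finite T]

/-- The composite of the cosets of `sectionLeft D` and `sectionRight D` is transitive, because
`sectionLeft D` projects onto `(p₁(D) / k₁(D)) × T`. -/
theorem section_comp_iso (D : Subgroup (G × G × T)) :
    ((compData G (LeftSection D) G T).prod (GSet.coset (sectionLeft D))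
      (GSet.coset (sectionRight D))).Iso (GSet.coset D) := by
  have h := GSet.iso_coset ((compData G (LeftSection D) G T).prod (GSet.coset (sectionLeft D))
    (GSet.coset (sectionRight D)))
    ((compData G (LeftSection D) G T).pt (GSet.cosetOne _) (GSet.cosetOne _)) ?_
  · rwa [stabilizer_pt, stabilizer_coset_one, stabilizer_coset_one, starProd_section] at h
  · refine AmalgData.ind _ fun x y => ?_
    obtain ⟨⟨a, q, t⟩, rfl⟩ := coset_transitive _ x
    obtain ⟨⟨q', l, t'⟩, rfl⟩ := coset_transitive _ y
    obtain ⟨⟨g, hg⟩, hgq⟩ := QuotientGroup.mk_surjective (q'⁻¹ * q)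
    -- `sectionLeft D` contains `(g, q'⁻¹ q, t'⁻¹ t)`, so `(a, q, t)` can be moved
    -- to `(a g⁻¹, q', t')`, which matches the middle and last entries of `(q', l, t')`.
    refine ⟨(a * g⁻¹, l, t'), ?_⟩
    rw [AmalgData.smul_pt, AmalgData.pt_eq_iff]
    refine ⟨q', ?_, ?_⟩
    · rw [smul_smul]
      rw [smul_cosetOne_eq_iff]
      have e : ((compData G (LeftSection D) G T).a q' *
          (compData G (LeftSection D) G T).c (a * g⁻¹, l, t'))⁻¹ * (a, q, t) =
          (g, q'⁻¹ * q, t'⁻¹ * t) := by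
        ext <;> simp [compData]
      rw [e]
      exact ⟨hg, hgq⟩
    · rw [smul_smul]
      simp [compData]

variable (k : Type v) [CommRing k]

theorem transCls_mem_factorIdeal {D : Subgroup (G × G × T)}
    (h : Nat.card (LeftSection D) < Nat.card G) : transCls k G T D ∈ factorIdeal k G T := by
  refine TwoSidedIdeal.mem_asIdeal.2 (TwoSidedIdeal.subset_span
    ⟨LeftSection D, inferInstance, inferInstance, h,
      1 ⊗ₜ BurnsideGroup.cls (GSet.coset (sectionLeft D)),
      1 ⊗ₜ BurnsideGroup.cls (GSet.coset (sectionRight D)), ?_⟩)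
  rw [kcomp_cls, endCls_eq k (section_comp_iso D)]
  rfl

end Factor

/-! ### Subgroups of `G × G × T` for coprime orders -/

section Coprime

variable {G T : Type u} [Group G] [Group T]

/-- When `G` and `T` have coprime orders, a power map kills `T` and is the identity on `G`. -/
theorem exists_pow_eq (hGT : Nat.Coprime (Nat.card G) (Nat.card T)) :
    ∃ n : ℕ, (∀ g : G, g ^ n = g) ∧ ∀ t : T, t ^ n = 1 := by
  obtain ⟨n, h1, h2⟩ := Nat.chineseRemainder hGT 1 0
  refine ⟨n, fun g => ?_, fun t => ?_⟩
  · conv_rhs => rw [← pow_one g]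
    exact pow_eq_pow_iff_modEq.2 (h1.of_dvd (orderOf_dvd_natCard g))
  · rw [← pow_zero t]
    exact pow_eq_pow_iff_modEq.2 (h2.of_dvd (orderOf_dvd_natCard t))

/-- For coprime orders, a subgroup of `G × G × T` is a product of its parts in `G × G` and `T`. -/
theorem mem_one_of_coprime (hGT : Nat.Coprime (Nat.card G) (Nat.card T))
    {D : Subgroup (G × G × T)} {a b : G} {t : T} (h : (a, b, t) ∈ D) :
    (a, b, (1 : T)) ∈ D := by
  obtain ⟨n, h1, h2⟩ := exists_pow_eq hGT
  have := D.pow_mem h n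
  rwa [Prod.pow_mk, Prod.pow_mk, h1, h1, h2] at this

theorem one_mem_of_coprime (hGT : Nat.Coprime (Nat.card G) (Nat.card T))
    {D : Subgroup (G × G × T)} {a b : G} {t : T} (h : (a, b, t) ∈ D) :
    ((1 : G), (1 : G), t) ∈ D := by
  simpa using D.mul_mem (D.inv_mem (mem_one_of_coprime hGT h)) h

theorem mem_directSubgroup_one {σ : MulAut G} {T₀ : Subgroup T} {a b : G} {t : T} :
    (a, b, t) ∈ directSubgroup σ T₀ 1 ↔ t ∈ T₀ ∧ a = σ b := by
  refine ⟨?_, ?_⟩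
  · rintro ⟨h, h'⟩
    exact ⟨h, h'.trans (one_mul _)⟩
  · rintro ⟨h, h'⟩
    exact ⟨h, h'.trans (one_mul _).symm⟩

theorem directSubgroup_not_starDecomposable [Finite G] (σ : MulAut G) (T₀ : Subgroup T)
    (α : T₀ →* Subgroup.center G) : ¬ StarDecomposable (directSubgroup σ T₀ α) := by
  have h1 : ((α ⟨1, T₀.one_mem⟩ : Subgroup.center G) : G) = 1 := by
    rw [show (⟨1, T₀.one_mem⟩ : T₀) = 1 from rfl, map_one]
    rfl
  refine not_starDecomposable σ σ.injective (fun g => ⟨T₀.one_mem, ?_⟩) ?_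
  · change σ g = ((α ⟨1, T₀.one_mem⟩ : Subgroup.center G) : G) * σ g
    rw [h1, one_mul]
  · rintro a g ⟨h, h'⟩
    change a = ((α ⟨1, T₀.one_mem⟩ : Subgroup.center G) : G) * σ g at h'
    rw [h', h1, one_mul]

/-- A subgroup `D` whose left section is all of `G` is some `D_{σ, 1, T₀}`: the part of `D` in
`G × G` is the graph of an automorphism, and coprimality splits off the part in `T`. -/
theorem eq_directSubgroup_of_card_not_lt [Finite G]
    (hGT : Nat.Coprime (Nat.card G) (Nat.card T)) {D : Subgroup (G × G × T)}
    (h : ¬ Nat.card (LeftSection D) < Nat.card G) :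
    ∃ (σ : MulAut G) (T₀ : Subgroup T), D = directSubgroup σ T₀ 1 := by
  -- The cardinality assumption forces `k₁(D) = 1` and `p₁(D) = G`.
  have hmul := Subgroup.card_eq_card_quotient_mul_card_subgroup
    ((leftKer D).subgroupOf (leftProj D))
  have hle := Subgroup.card_le_card_group (leftProj D)
  have hG : 0 < Nat.card G := Nat.card_pos
  have hk : Nat.card ((leftKer D).subgroupOf (leftProj D)) = 1 := by
    have : 0 < Nat.card ((leftKer D).subgroupOf (leftProj D)) := Nat.card_pos
    nlinarith
  rw [hk, mul_one] at hmul
  have hP : leftProj D = ⊤ := Subgroup.eq_top_of_card_eq _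
    (le_antisymm hle (hmul ▸ not_lt.1 h))
  have hK : ∀ g, (g, (1 : G), (1 : T)) ∈ D → g = 1 := by
    intro g hg
    have hg' : g ∈ leftKer D := mem_leftKer.2 hg
    have := Subgroup.mem_bot.1 (Subgroup.card_eq_one.1 hk ▸
      (Subgroup.mem_subgroupOf (h := ⟨g, leftKer_le D hg'⟩)).2 hg')
    exact congrArg Subtype.val this
  have huniq : ∀ a a' b, (a, b, (1 : T)) ∈ D → (a', b, (1 : T)) ∈ D → a = a' := by
    intro a a' b h1 h2
    have := hK (a * a'⁻¹) (by simpa using D.mul_mem h1 (D.inv_mem h2))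
    exact mul_inv_eq_one.1 this
  have hex : ∀ a, ∃ b, (a, b, (1 : T)) ∈ D := by
    intro a
    obtain ⟨l, t, h1⟩ := mem_leftProj.1 (hP ▸ Subgroup.mem_top a)
    exact ⟨l, mem_one_of_coprime hGT h1⟩
  -- `φ` is injective as `k₁(D) = 1`, hence surjective; its inverse `ψ` is the automorphism.
  choose φ hφ using hex
  have hinj : Function.Injective φ := fun a a' e =>
    huniq _ _ (φ a) (hφ a) (e ▸ hφ a')
  have hsurj := Finite.surjective_of_injective hinj
  have hex' : ∀ b, ∃ a, (a, b, (1 : T)) ∈ D := fun b => by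
    obtain ⟨a, rfl⟩ := hsurj b
    exact ⟨a, hφ a⟩
  choose ψ hψ using hex'
  let f : G →* G := MonoidHom.mk' ψ fun a b =>
    huniq _ _ (a * b) (hψ _) (by simpa using D.mul_mem (hψ a) (hψ b))
  have hf : Function.Surjective f := fun a => ⟨φ a, huniq _ _ _ (hψ _) (hφ a)⟩
  refine ⟨MulEquiv.ofBijective f ⟨Finite.injective_iff_surjective.2 hf, hf⟩,
    D.comap ((MonoidHom.inr G (G × T)).comp (MonoidHom.inr G T)), ?_⟩
  ext ⟨a, b, t⟩
  rw [mem_directSubgroup_one]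
  constructor
  · intro h1
    exact ⟨one_mem_of_coprime hGT h1, huniq _ _ b (mem_one_of_coprime hGT h1) (hψ b)⟩
  · rintro ⟨h1, rfl⟩
    have : (ψ b * 1, b * 1, 1 * t) ∈ D := D.mul_mem (hψ b) h1
    rwa [mul_one, mul_one, one_mul] at this

theorem eq_directSubgroup [Finite G] (hGT : Nat.Coprime (Nat.card G) (Nat.card T))
    {D : Subgroup (G × G × T)} (hD : ¬ StarDecomposable D) :
    ∃ (σ : MulAut G) (T₀ : Subgroup T), D = directSubgroup σ T₀ 1 :=
  eq_directSubgroup_of_card_not_lt hGT fun h => hD (starDecomposable_of_card_lt h)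

variable (k : Type v) [CommRing k] [Finite G] [Finite T]

theorem setLp_eq_setLs (hGT : Nat.Coprime (Nat.card G) (Nat.card T)) :
    setLp k G T = setLs k G T := by
  refine Set.Subset.antisymm ?_ ?_
  · rintro _ ⟨σ, T₀, α, rfl⟩
    exact ⟨_, directSubgroup_not_starDecomposable σ T₀ α, rfl⟩
  · rintro _ ⟨D, hD, rfl⟩
    obtain ⟨σ, T₀, rfl⟩ := eq_directSubgroup hGT hD
    exact ⟨σ, T₀, 1, rfl⟩

theorem setLs_eq_setG (hGT : Nat.Coprime (Nat.card G) (Nat.card T)) :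
    setLs k G T = setG k G T := by
  refine Set.Subset.antisymm ?_ ?_
  · rintro _ ⟨D, hD, rfl⟩
    obtain ⟨σ, T₀, rfl⟩ := eq_directSubgroup hGT hD
    refine ⟨(⊤ : Subgroup G).prod T₀,
      (σ.toMonoidHom.comp (MonoidHom.fst G T)).comp (Subgroup.subtype _),
      fun g => ⟨1, Subgroup.mem_prod.2 ⟨Subgroup.mem_top g, T₀.one_mem⟩⟩,
      fun g => ⟨⟨(σ.symm g, 1), Subgroup.mem_prod.2 ⟨Subgroup.mem_top _, T₀.one_mem⟩⟩,
        σ.apply_symm_apply g⟩,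
      fun g _ h => (map_eq_one_iff σ σ.injective).1 h, ?_⟩
    congr 2
    ext ⟨a, b, t⟩
    rw [mem_directSubgroup_one]
    constructor
    · rintro ⟨h, h'⟩
      exact ⟨Subgroup.mem_prod.2 ⟨Subgroup.mem_top _, h⟩, h'⟩
    · rintro ⟨h, h'⟩
      exact ⟨(Subgroup.mem_prod.1 h).2, h'⟩
  · rintro _ ⟨A, f, hA, -, hf, rfl⟩
    refine ⟨_, ?_, rfl⟩
    obtain ⟨n, h1, h2⟩ := exists_pow_eq hGT
    have hA1 : ∀ g, (g, (1 : T)) ∈ A := fun g => by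
      obtain ⟨t, ht⟩ := hA g
      have := A.pow_mem ht n
      rwa [Prod.pow_mk, h1, h2] at this
    -- The condition on the kernel of `f` makes `g ↦ f (g, 1)` injective.
    refine not_starDecomposable (fun g => f ⟨(g, 1), hA1 g⟩) ?_ (fun g => ⟨hA1 g, rfl⟩) ?_
    · intro g g' e
      refine mul_inv_eq_one.1 (hf (g * g'⁻¹) (hA1 _) ?_)
      have h3 : (⟨(g * g'⁻¹, 1), hA1 _⟩ : A) = ⟨(g, 1), hA1 g⟩ * ⟨(g', 1), hA1 g'⟩⁻¹ :=
        Subtype.ext (Prod.ext rfl (by simp))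
      rw [h3, map_mul, map_inv]
      exact mul_inv_eq_one.2 e
    · rintro a g ⟨h, h'⟩
      exact h'

/-- Modulo `I_T(G)`, every element of `kB_T(G × G)` is a combination of the classes
of the `D_{σ, 1, T₀}`. -/
theorem span_directSubgroup (hGT : Nat.Coprime (Nat.card G) (Nat.card T)) :
    Submodule.span k {x | ∃ (σ : MulAut G) (T₀ : Subgroup T),
      x = essProj k G T (transCls k G T (directSubgroup σ T₀ 1))} = ⊤ := by
  set M := Submodule.span k {x | ∃ (σ : MulAut G) (T₀ : Subgroup T),
      x = essProj k G T (transCls k G T (directSubgroup σ T₀ 1))} with hM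
  have htrans : ∀ D, essProj k G T (transCls k G T D) ∈ M := by
    intro D
    by_cases h : Nat.card (LeftSection D) < Nat.card G
    · have : essProj k G T (transCls k G T D) = 0 :=
        Ideal.Quotient.eq_zero_iff_mem.2 (transCls_mem_factorIdeal k h)
      rw [this]
      exact M.zero_mem
    · obtain ⟨σ, T₀, rfl⟩ := eq_directSubgroup_of_card_not_lt hGT h
      exact Submodule.subset_span ⟨σ, T₀, rfl⟩
  refine top_le_iff.1 fun y _ => ?_
  obtain ⟨x, rfl⟩ := Ideal.Quotient.mk_surjective y
  refine tmul_mem_of_cls (Γ := G × G × T) k (M.comap (essProj k G T).toLinearMap) (fun X => ?_) x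
  let f : BurnsideGroup (G × G × T) →+ EssentialAlgebra k G T :=
    AddMonoidHom.mk' (fun b => essProj k G T ((1 : k) ⊗ₜ[ℤ] EndB.of b)) fun a b => by
      rw [map_add, TensorProduct.tmul_add, map_add]
  exact cls_mem_of_orbits (M.toAddSubgroup.comap f) X fun x => htrans _

end Coprime

/-! ### The homomorphism from `kB^{Z(G)}(T) ⋊ Out(G)` to `kB_T(G × G)` -/

section Twisted

variable (G T : Type u) [Group G] [Group T]

/-- The data of the product `X ×_{Z(G)} U` of a `G × G × Z(G)`-set `X` and a `T × Z(G)`-set `U`, on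
which `G × G × T` acts. -/
def twistedData : AmalgData (Subgroup.center G) (G × G × Subgroup.center G)
    (T × Subgroup.center G) (G × G × T) where
  a := MonoidHom.mk' (fun z => (1, 1, z)) (by simp)
  b := MonoidHom.mk' (fun z => (1, z)) (by simp)
  c := MonoidHom.mk' (fun r => (r.1, r.2.1, 1)) (by simp)
  d := MonoidHom.mk' (fun r => (r.2.2, 1)) (by simp)
  comm_left := by simp
  comm_right := by simp

variable {G} [Finite G]

/-- The `G × G × Z(G)`-set `G`, with action `(a, b, z) • x = a * x * σ(b)⁻¹ * z⁻¹`. -/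
def GSet.twistedDiag (σ : MulAut G) : GSet (G × G × Subgroup.center G) where
  carrier := G
  act :=
    { smul := fun r x => r.1 * x * (σ r.2.1)⁻¹ * (r.2.2 : G)⁻¹
      one_smul := fun x => by
        change (1 : G) * x * (σ (1 : G))⁻¹ * (1 : G)⁻¹ = x
        simp
      mul_smul := fun r s x => by
        change (r.1 * s.1) * x * (σ (r.2.1 * s.2.1))⁻¹ * ((r.2.2 : G) * s.2.2)⁻¹ =
          r.1 * (s.1 * x * (σ s.2.1)⁻¹ * (s.2.2 : G)⁻¹) * (σ r.2.1)⁻¹ * (r.2.2 : G)⁻¹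
        have h := Subgroup.mem_center_iff.1 (inv_mem s.2.2.2) (σ r.2.1)⁻¹
        rw [map_mul, mul_inv_rev, mul_inv_rev]
        simp only [mul_assoc]
        rw [← mul_assoc (s.2.2 : G)⁻¹ (σ r.2.1)⁻¹, ← h, mul_assoc] }

variable {T}

/-- The `G × G × T`-set `G ×_{Z(G)} U`, with `G × G` acting on `G`
by `(a, b) • x = a * x * σ(b)⁻¹`. -/
def GSet.twisted (σ : MulAut G) (U : GSet (T × Subgroup.center G)) : GSet (G × G × T) :=
  (twistedData G T).prod (GSet.twistedDiag σ) U

/-- The class of `(x, u)` in `G ×_{Z(G)} U`. -/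
def twistedPt (σ : MulAut G) {U : GSet (T × Subgroup.center G)} (x : G) (u : U.carrier) :
    (GSet.twisted σ U).carrier :=
  (twistedData G T).pt (X := GSet.twistedDiag σ) x u

variable {σ τ : MulAut G} {U V : GSet (T × Subgroup.center G)}

theorem twistedPt_ind {p : (GSet.twisted σ U).carrier → Prop}
    (h : ∀ x u, p (twistedPt σ x u)) (z) : p z :=
  (twistedData G T).ind (X := GSet.twistedDiag σ) h z

theorem twistedPt_eq_iff {x x' : G} {u u' : U.carrier} :
    twistedPt σ x u = twistedPt σ x' u' ↔
      ∃ z : Subgroup.center G, x * (z : G)⁻¹ = x' ∧ ((1 : T), z) • u = u' := by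
  refine ((twistedData G T).pt_eq_iff (X := GSet.twistedDiag σ)).trans
    (exists_congr fun z => and_congr_left fun _ => ?_)
  change (1 : G) * x * (σ (1 : G))⁻¹ * (z : G)⁻¹ = x' ↔ _
  rw [map_one, inv_one, one_mul, mul_one]

theorem smul_twistedPt (r : G × G × T) (x : G) (u : U.carrier) :
    r • twistedPt σ x u = twistedPt σ (r.1 * x * (σ r.2.1)⁻¹) ((r.2.2, (1 : Subgroup.center G)) • u) := by
  refine ((twistedData G T).smul_pt (X := GSet.twistedDiag σ) r x u).trans ?_
  refine congrArg (fun y => (twistedData G T).pt (X := GSet.twistedDiag σ) y _) ?_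
  change r.1 * x * (σ r.2.1)⁻¹ * (1 : G)⁻¹ = _
  rw [inv_one, mul_one]

/-- A criterion for recognizing `G ×_{Z(G)} U`. -/
theorem twisted_iso_of {Y : GSet (G × G × T)} (f : G → U.carrier → Y.carrier)
    (hf : ∀ (z : Subgroup.center G) x u, f (x * (z : G)⁻¹) (((1 : T), z) • u) = f x u)
    (hinj : ∀ x u x' u', f x u = f x' u' →
      ∃ z : Subgroup.center G, x * (z : G)⁻¹ = x' ∧ ((1 : T), z) • u = u')
    (hsurj : ∀ y, ∃ x u, f x u = y)
    (hr : ∀ (r : G × G × T) x u,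
      f (r.1 * x * (σ r.2.1)⁻¹) ((r.2.2, (1 : Subgroup.center G)) • u) = r • f x u) :
    (GSet.twisted σ U).Iso Y := by
  have ha : ∀ (z : Subgroup.center G) (x : G),
      (twistedData G T).a z • (show (GSet.twistedDiag σ).carrier from x) = x * (z : G)⁻¹ := by
    intro z x
    change (1 : G) * x * (σ (1 : G))⁻¹ * (z : G)⁻¹ = _
    rw [map_one, inv_one, one_mul, mul_one]
  have hc : ∀ (r : G × G × T) (x : G),
      (twistedData G T).c r • (show (GSet.twistedDiag σ).carrier from x) =
        r.1 * x * (σ r.2.1)⁻¹ := by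
    intro r x
    change r.1 * x * (σ r.2.1)⁻¹ * (1 : G)⁻¹ = _
    rw [inv_one, mul_one]
  refine (twistedData G T).iso_of (X := GSet.twistedDiag σ) f ?_ ?_ hsurj ?_
  · intro z x u
    exact (congrArg (fun y => f y _) (ha z x)).trans (hf z x u)
  · intro x u x' u' h
    obtain ⟨z, h1, h2⟩ := hinj x u x' u' h
    exact ⟨z, (ha z x).trans h1, h2⟩
  · intro r x u
    exact (congrArg (fun y => f y _) (hc r x)).trans (hr r x u)

/-- `G ×_{Z(G)} U` depends only on the class of `σ` in `Out(G)`. -/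
theorem twistedDiag_iso (h : (τ : Out G) = (σ : Out G)) :
    (GSet.twistedDiag σ).Iso (GSet.twistedDiag τ) := by
  obtain ⟨a, ha⟩ := QuotientGroup.eq.1 h
  have hσ : σ = τ * MulAut.conj a := by rw [ha, mul_inv_cancel_left]
  refine ⟨Equiv.mulRight (G := G) (τ a), fun r (x : G) => ?_⟩
  change (r.1 * x * (σ r.2.1)⁻¹ * (r.2.2 : G)⁻¹) * τ a =
    r.1 * (x * τ a) * (τ r.2.1)⁻¹ * (r.2.2 : G)⁻¹
  have hc := Subgroup.mem_center_iff.1 (inv_mem r.2.2.2) (τ a)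
  rw [mul_assoc _ _ (τ a), ← hc, hσ]
  simp [mul_assoc]

theorem twisted_iso_of_out_eq (h : (τ : Out G) = (σ : Out G))
    (U : GSet (T × Subgroup.center G)) : (GSet.twisted σ U).Iso (GSet.twisted τ U) :=
  (twistedData G T).prod_iso (twistedDiag_iso h) (GSet.Iso.refl U)

theorem twisted_one_iso (h : (σ : Out G) = 1) :
    (GSet.twisted σ (GSet.trivialFibre T (Subgroup.center G))).Iso (GSet.diag G T) := by
  refine (twisted_iso_of_out_eq (τ := 1) h.symm _).trans ?_
  refine twisted_iso_of (fun (x : G) (u : Subgroup.center G) => (x * u : G)) ?_ ?_ ?_ ?_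
  · intro z x (u : Subgroup.center G)
    change x * (z : G)⁻¹ * ((z : G) * u) = x * u
    group
  · intro x (u : Subgroup.center G) x' (u' : Subgroup.center G) (h : x * (u : G) = x' * u')
    refine ⟨u' * u⁻¹, ?_, ?_⟩
    · change x * ((u' : G) * (u : G)⁻¹)⁻¹ = x'
      rw [mul_inv_rev, inv_inv, ← mul_assoc, h, mul_inv_cancel_right]
    · change u' * u⁻¹ * u = u'
      group
  · exact fun y => ⟨y, (1 : Subgroup.center G), mul_one (M := G) _⟩
  · intro r x (u : Subgroup.center G)
    change r.1 * x * (r.2.1)⁻¹ * ((1 : Subgroup.center G) * u : Subgroup.center G) =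
      r.1 * (x * u) * (r.2.1)⁻¹
    have hc := Subgroup.mem_center_iff.1 u.2 (r.2.1)⁻¹
    rw [one_mul, mul_assoc _ _ (u : G), hc]
    simp only [mul_assoc]

omit [Finite G] in
theorem outCenter_coe (τ : MulAut G) (z : Subgroup.center G) :
    ((outCenter G (τ : Out G) z : Subgroup.center G) : G) = τ (z : G) := rfl

/-- A map out of `G ×_{Z(G)} U`. -/
def twistedLift {A : Type*} (f : G → U.carrier → A)
    (hf : ∀ (z : Subgroup.center G) x u, f (x * (z : G)⁻¹) (((1 : T), z) • u) = f x u) :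
    (GSet.twisted σ U).carrier → A :=
  (twistedData G T).liftFun (X := GSet.twistedDiag σ) f fun z (x : G) u => by
    refine Eq.trans ?_ (hf z x u)
    change f ((1 : G) * x * (σ (1 : G))⁻¹ * (z : G)⁻¹) _ = _
    rw [map_one, inv_one, one_mul, mul_one]
    rfl

/-- The point `[v, u]` of the product of `V` and `τ(U)`. -/
def fibPt (τ : MulAut G) (v : V.carrier) (u : U.carrier) :
    ((fibData T _).prod V (U.twist (outCenter G (τ : Out G)))).carrier :=
  (fibData T _).pt (Y := U.twist (outCenter G (τ : Out G))) v u

omit [Finite G] in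
theorem fibPt_eq_iff {v v' : V.carrier} {u u' : U.carrier} :
    fibPt τ v u = fibPt τ v' u' ↔ ∃ z : Subgroup.center G, ((1 : T), z⁻¹) • v = v' ∧
      ((1 : T), (outCenter G (τ : Out G))⁻¹ z) • u = u' :=
  (fibData T _).pt_eq_iff (Y := U.twist (outCenter G (τ : Out G)))

omit [Finite G] in
theorem smul_fibPt (r : T × Subgroup.center G) (v : V.carrier) (u : U.carrier) :
    r • fibPt τ v u = fibPt τ (r • v) ((r.1, (1 : Subgroup.center G)) • u) := by
  refine ((fibData T _).smul_pt (Y := U.twist (outCenter G (τ : Out G))) r v u).trans ?_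
  change fibPt τ (r • v) ((r.1, (outCenter G (τ : Out G))⁻¹ 1) • u) = _
  rw [map_one]

theorem twistedPt_mul (x : G) (z : Subgroup.center G) (u : U.carrier) :
    twistedPt σ (x * z) u = twistedPt σ x (((1 : T), z) • u) :=
  twistedPt_eq_iff.2 ⟨z, mul_inv_cancel_right _ _, rfl⟩

/-- The map `([x, v], [y, u]) ↦ [x τ(y), [v, u]]`. -/
def twistedMul (τ σ : MulAut G) (V U : GSet (T × Subgroup.center G)) :
    (GSet.twisted τ V).carrier → (GSet.twisted σ U).carrier →
    (GSet.twisted (τ * σ) ((fibData T _).prod V (U.twist (outCenter G (τ : Out G))))).carrier :=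
  twistedLift (fun x v => twistedLift (fun y u => twistedPt (τ * σ) (x * τ y) (fibPt τ v u))
    fun z y u => by
      have h : x * τ (y * (z : G)⁻¹) =
          x * τ y * ((outCenter G (τ : Out G) z)⁻¹ : Subgroup.center G) := by
        rw [map_mul, map_inv, Subgroup.coe_inv, outCenter_coe, mul_assoc]
      rw [h, twistedPt_mul, smul_fibPt]
      refine congrArg _ (fibPt_eq_iff.2 ⟨(outCenter G (τ : Out G) z)⁻¹, ?_, ?_⟩)
      · rw [smul_smul, inv_inv, Prod.mk_mul_mk, mul_one, mul_inv_cancel]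
        exact one_smul _ v
      · rw [smul_smul, smul_smul, map_inv, MulAut.inv_apply_self]
        simp only [Prod.mk_mul_mk, mul_one, inv_mul_cancel]
        exact one_smul _ u) fun z x v => by
    funext w
    induction w using twistedPt_ind with
    | h y u =>
    change twistedPt (τ * σ) (x * (z : G)⁻¹ * τ y) (fibPt τ (((1 : T), z) • v) u) =
      twistedPt (τ * σ) (x * τ y) (fibPt τ v u)
    have h : x * (z : G)⁻¹ * τ y = x * τ y * (z⁻¹ : Subgroup.center G) := by
      rw [mul_assoc, mul_assoc, Subgroup.coe_inv,
        Subgroup.mem_center_iff.1 (inv_mem z.2) (τ y)]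
    rw [h, twistedPt_mul, smul_fibPt, smul_smul, Prod.mk_mul_mk, mul_one, inv_mul_cancel]
    refine congrArg _ (congrArg₂ _ (one_smul _ v) (one_smul _ u))

theorem twistedMul_pt (x y : G) (v : V.carrier) (u : U.carrier) :
    twistedMul τ σ V U (twistedPt τ x v) (twistedPt σ y u) =
      twistedPt (τ * σ) (x * τ y) (fibPt τ v u) := rfl

/-- `(G ×_Z V) ×_G^d (G ×_Z U)` is isomorphic to `G ×_Z (V ×_Z τ(U))`. -/
theorem twisted_comp_iso (τ σ : MulAut G) (V U : GSet (T × Subgroup.center G)) :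
    ((compData G G G T).prod (GSet.twisted τ V) (GSet.twisted σ U)).Iso
      (GSet.twisted (τ * σ) ((fibData T _).prod V (U.twist (outCenter G (τ : Out G))))) := by
  have ha : ∀ (s x : G) (v : V.carrier), (compData G G G T).a s • twistedPt τ x v =
      twistedPt τ (x * (τ s)⁻¹) v := fun s x v => by
    rw [smul_twistedPt]
    change twistedPt τ (1 * x * (τ s)⁻¹) (((1 : T), (1 : Subgroup.center G)) • v) = _
    rw [one_mul]
    exact congrArg _ (one_smul _ v)
  have hb : ∀ (s y : G) (u : U.carrier), (compData G G G T).b s • twistedPt σ y u =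
      twistedPt σ (s * y) u := fun s y u => by
    rw [smul_twistedPt]
    change twistedPt σ (s * y * (σ 1)⁻¹) (((1 : T), (1 : Subgroup.center G)) • u) = _
    rw [map_one, inv_one, mul_one]
    exact congrArg _ (one_smul _ u)
  refine (compData G G G T).iso_of (twistedMul τ σ V U) ?_ ?_ ?_ ?_
  · intro s
    refine twistedPt_ind fun x v => twistedPt_ind fun y u => ?_
    rw [ha, hb, twistedMul_pt, twistedMul_pt, map_mul, mul_assoc, inv_mul_cancel_left]
  · refine twistedPt_ind fun x v => twistedPt_ind fun y u =>
      twistedPt_ind fun x' v' => twistedPt_ind fun y' u' => ?_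
    rw [twistedMul_pt, twistedMul_pt, twistedPt_eq_iff]
    rintro ⟨z, h1, h2⟩
    rw [smul_fibPt, fibPt_eq_iff] at h2
    obtain ⟨w, h2, h3⟩ := h2
    obtain ⟨ζ, rfl⟩ := (outCenter G (τ : Out G)).surjective w
    rw [MulAut.inv_apply_self, smul_smul, Prod.mk_mul_mk, mul_one, mul_one] at h3
    rw [smul_smul, Prod.mk_mul_mk, mul_one] at h2
    -- The element of `G` relating the representatives has to satisfy `s y = y' ζ`, because the
    -- second components of the two middle points differ by the central element `ζ`.
    have hy : τ y' = x'⁻¹ * (x * τ y * (z : G)⁻¹) := by rw [h1, inv_mul_cancel_left]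
    refine ⟨y' * ζ * y⁻¹, ?_, ?_⟩
    · rw [ha, twistedPt_eq_iff]
      refine ⟨(outCenter G (τ : Out G) ζ)⁻¹ * z, ?_, h2⟩
      have hτ : τ (y' * ζ * y⁻¹) = x'⁻¹ * (x * τ y) *
          (((outCenter G (τ : Out G) ζ)⁻¹ * z : Subgroup.center G) : G)⁻¹ * (τ y)⁻¹ := by
        rw [map_mul, map_mul, map_inv, hy, ← outCenter_coe, Subgroup.coe_mul, mul_inv_rev,
          Subgroup.coe_inv, inv_inv]
        simp only [mul_assoc]
      generalize (outCenter G (τ : Out G) ζ)⁻¹ * z = m at hτ ⊢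
      have hm := Subgroup.mem_center_iff.1 m.2 ((τ y)⁻¹ * x⁻¹ * x')
      calc x * (τ (y' * ζ * y⁻¹))⁻¹ * (m : G)⁻¹
          = x * τ y * (m * ((τ y)⁻¹ * x⁻¹ * x')) * (m : G)⁻¹ := by rw [hτ]; group
        _ = x' := by rw [← hm]; group
    · rw [hb, twistedPt_eq_iff]
      exact ⟨ζ, by simp, h3⟩
  · refine twistedPt_ind fun x => (fibData T _).ind (Y := U.twist (outCenter G (τ : Out G)))
      fun v (u : U.carrier) => ⟨twistedPt τ x v, twistedPt σ 1 u, ?_⟩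
    change twistedPt (τ * σ) (x * τ 1) (fibPt τ v u) = twistedPt (τ * σ) x (fibPt τ v u)
    rw [map_one, mul_one]
  · intro r
    refine twistedPt_ind fun x v => twistedPt_ind fun y u => ?_
    rw [smul_twistedPt, smul_twistedPt, twistedMul_pt, twistedMul_pt, smul_twistedPt, smul_fibPt]
    refine congrArg₂ _ ?_ rfl
    simp [compData, mul_assoc]

variable (T)

/-- The additive extension of `U ↦ G ×_{Z(G)} U`. -/
def twistedB (σ : MulAut G) : FibB T (Subgroup.center G) →+ EndB G T :=
  (EndB.of.toAddMonoidHom.comp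
    ((twistedData G T).bprod (BurnsideGroup.cls (GSet.twistedDiag σ)))).comp
      (FibB.of T (Subgroup.center G)).symm.toAddMonoidHom

variable (k : Type v) [CommRing k]

/-- The `k`-linear extension of `U ↦ G ×_{Z(G)} U`. -/
def twistedK (σ : MulAut G) : KFibB T (Subgroup.center G) k →ₗ[k] KEndB k G T :=
  (twistedB T σ).toIntLinearMap.baseChange k

variable {T}

theorem twistedK_fibCls (σ : MulAut G) (U : GSet (T × Subgroup.center G)) :
    twistedK T k σ (fibCls k U) = endCls k (GSet.twisted σ U) := by
  refine (LinearMap.baseChange_tmul _ _ _).trans ?_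
  exact congrArg (fun b => (1 : k) ⊗ₜ[ℤ] EndB.of b) ((twistedData G T).bprod_cls _ _)

theorem linearMap_ext_fibCls {M : Type*} [AddCommGroup M] [Module k M]
    {f g : KFibB T (Subgroup.center G) k →ₗ[k] M} (h : ∀ U, f (fibCls k U) = g (fibCls k U)) :
    f = g :=
  LinearMap.ext fun x =>
    tmul_mem_of_cls (Γ := T × Subgroup.center G) k (LinearMap.eqLocus f g) h x

theorem twistedK_eq_of_out_eq (h : (τ : Out G) = (σ : Out G)) :
    twistedK T k τ = twistedK T k σ :=
  linearMap_ext_fibCls k fun U => by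
    rw [twistedK_fibCls, twistedK_fibCls, endCls_eq k (twisted_iso_of_out_eq h U)]

theorem twistedK_one (h : (σ : Out G) = 1) : twistedK T k σ 1 = 1 := by
  refine (twistedK_fibCls k σ (GSet.trivialFibre T (Subgroup.center G))).trans ?_
  exact endCls_eq k (twisted_one_iso h)

theorem twistedK_mul (τ σ : MulAut G) (v u : KFibB T (Subgroup.center G) k) :
    twistedK T k τ v * twistedK T k σ u =
      twistedK T k (τ * σ) (v * twistAlgHom k (outCenter G (τ : Out G)) u) := by
  have h1 : ∀ V, ((LinearMap.mulLeft k (twistedK T k τ (fibCls k V))).comp (twistedK T k σ)) =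
      (twistedK T k (τ * σ)).comp ((LinearMap.mulLeft k (fibCls k V)).comp
        (twistAlgHom k (outCenter G (τ : Out G))).toLinearMap) := fun V =>
    linearMap_ext_fibCls k fun U => by
      change twistedK T k τ (fibCls k V) * twistedK T k σ (fibCls k U) =
        twistedK T k (τ * σ) (fibCls k V * twistAlgHom k (outCenter G (τ : Out G)) (fibCls k U))
      rw [twistAlgHom_fibCls, fibCls_mul, twistedK_fibCls, twistedK_fibCls, twistedK_fibCls,
        endCls_mul, endCls_eq k (twisted_comp_iso τ σ V U)]
  have h2 : ((LinearMap.mulRight k (twistedK T k σ u)).comp (twistedK T k τ)) =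
      (twistedK T k (τ * σ)).comp
        (LinearMap.mulRight k (twistAlgHom k (outCenter G (τ : Out G)) u)) :=
    linearMap_ext_fibCls k fun V => LinearMap.congr_fun (h1 V) u
  exact LinearMap.congr_fun h2 v

variable (G T)

/-- The linear map sending `u_σ` to the class of `G ×_{Z(G)} U` if `u` is the class of `U`. It is
computed with a chosen representative of `σ` in `Aut(G)`. -/
def semidirectLin : SemidirectOut G k T →ₗ[k] KEndB k G T :=
  (Finsupp.lsum k fun s : Out G => (twistedK T k s.out).comp
    (MonomialBurnside.incl (T := T) (C := Subgroup.center G) k).toLinearMap).comp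
    (SkewMonoidAlgebra.coeffLinearEquiv (S := k)).toLinearMap

theorem semidirectLin_single (s : Out G) (u : MonomialBurnside T (Subgroup.center G) k) :
    semidirectLin G T k (SkewMonoidAlgebra.single s u) =
      twistedK T k s.out (MonomialBurnside.incl k u) := by
  refine (Finsupp.sum_single_index ?_)
  exact map_zero _

/-- The algebra homomorphism from `kB^{Z(G)}(T) ⋊ Out(G)` to `kB_T(G × G)` sending `u_σ` to the
class of `G ×_{Z(G)} U` if `u` is the class of `U`. -/
def semidirectHom : SemidirectOut G k T →ₐ[k] KEndB k G T :=
  AlgHom.ofLinearMap (semidirectLin G T k)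
    (by
      rw [SkewMonoidAlgebra.one_def, semidirectLin_single, map_one]
      exact twistedK_one k (Quotient.out_eq' (1 : Out G)))
    (by
      intro x y
      induction x using SkewMonoidAlgebra.induction_on' with
      | add a b ha hb => rw [add_mul, map_add, map_add, add_mul, ha, hb]
      | single s v =>
      induction y using SkewMonoidAlgebra.induction_on' with
      | add a b ha hb => rw [mul_add, map_add, map_add, mul_add, ha, hb]
      | single t u =>
      rw [semidirectOut_mul, semidirectLin_single, semidirectLin_single, semidirectLin_single,
        twistedK_mul, map_mul]
      have h : ((s * t).out : Out G) = ((s.out * t.out : MulAut G) : Out G) := by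
        rw [QuotientGroup.mk_mul, QuotientGroup.out_eq', QuotientGroup.out_eq',
          QuotientGroup.out_eq']
      rw [twistedK_eq_of_out_eq k h, QuotientGroup.out_eq']
      rfl)

theorem semidirectHom_single (s : Out G) (u : MonomialBurnside T (Subgroup.center G) k) :
    semidirectHom G T k (SkewMonoidAlgebra.single s u) =
      twistedK T k s.out (MonomialBurnside.incl k u) := semidirectLin_single G T k s u

end Twisted

/-! ### Points fixed by the graph of an automorphism -/

section GraphFix

variable {G T : Type u} [Group G] [Group T] (σ : MulAut G)

/-- The points of `X` whose stabilizer in `G × G` is the graph `{(σ g, g)}` of `σ`. -/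
def IsGraphPoint (X : GSet (G × G × T)) (x : X.carrier) : Prop :=
  (∀ g : G, (σ g, g, (1 : T)) • x = x) ∧
    ∀ a : G, (a, (1 : G), (1 : T)) • x = x → a = 1

/-- The homomorphism `(t, z) ↦ (z, 1, t)`. -/
def centralHom (G T : Type u) [Group G] [Group T] : T × Subgroup.center G →* G × G × T :=
  MonoidHom.mk' (fun r => ((r.2 : G), 1, r.1)) (by simp)

variable {σ}

theorem IsGraphPoint.smul {X : GSet (G × G × T)} (r : T × Subgroup.center G) {x : X.carrier}
    (hx : IsGraphPoint σ X x) : IsGraphPoint σ X (centralHom G T r • x) := by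
  refine ⟨fun g => ?_, fun a ha => ?_⟩
  · have h : (σ g, g, (1 : T)) * centralHom G T r = centralHom G T r * (σ g, g, (1 : T)) := by
      have hc := Subgroup.mem_center_iff.1 r.2.2 (σ g)
      simp [centralHom, hc]
    rw [smul_smul, h, mul_smul, hx.1]
  · have h : (centralHom G T r)⁻¹ * (a, (1 : G), (1 : T)) * centralHom G T r =
        (a, (1 : G), (1 : T)) := by
      have hc := Subgroup.mem_center_iff.1 r.2.2 a
      simp [centralHom, mul_assoc, hc]
    refine hx.2 a ?_
    rw [← h, mul_smul, mul_smul, ha, inv_smul_smul]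

variable (σ)

/-- The `T × Z(G)`-set of the points of `X` whose stabilizer in `G × G` is the graph of `σ`, with
the action `(t, z) • x = (z, 1, t) • x`. -/
def GSet.graphFix (X : GSet (G × G × T)) : GSet (T × Subgroup.center G) :=
  (X.res (centralHom G T)).sub (IsGraphPoint σ X) fun r _ hx => hx.smul r

variable {σ}

theorem graphFix_iso {X Y : GSet (G × G × T)} (h : X.Iso Y) :
    (GSet.graphFix σ X).Iso (GSet.graphFix σ Y) := by
  obtain ⟨e, he⟩ := h
  refine ⟨e.subtypeEquiv fun x => ?_, fun r x => Subtype.ext (he _ x.1)⟩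
  simp only [IsGraphPoint, ← he, e.injective.eq_iff]

theorem graphFix_sum (X Y : GSet (G × G × T)) :
    (GSet.graphFix σ (X.sum Y)).Iso ((GSet.graphFix σ X).sum (GSet.graphFix σ Y)) := by
  have hl : ∀ x, IsGraphPoint σ (X.sum Y) (Sum.inl x) ↔ IsGraphPoint σ X x := fun x =>
    and_congr (forall_congr' fun g => Sum.inl_injective.eq_iff)
      (forall_congr' fun g => imp_congr_left Sum.inl_injective.eq_iff)
  have hr : ∀ y, IsGraphPoint σ (X.sum Y) (Sum.inr y) ↔ IsGraphPoint σ Y y := fun y =>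
    and_congr (forall_congr' fun g => Sum.inr_injective.eq_iff)
      (forall_congr' fun g => imp_congr_left Sum.inr_injective.eq_iff)
  refine ⟨Equiv.subtypeSum.trans
    (Equiv.sumCongr (Equiv.subtypeEquivRight hl) (Equiv.subtypeEquivRight hr)), ?_⟩
  rintro r ⟨x | x, hx⟩ <;> rfl

/-- A point whose stabilizer in `G × G` is the graph of an automorphism has an indecomposable
stabilizer. -/
theorem IsGraphPoint.not_starDecomposable [Finite G] {X : GSet (G × G × T)} {x : X.carrier}
    (hx : IsGraphPoint σ X x) :
    ¬ StarDecomposable (MulAction.stabilizer (G × G × T) x) := by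
  refine ShiftedBurnside.not_starDecomposable σ σ.injective hx.1 fun a g h => ?_
  refine mul_inv_eq_one.1 (hx.2 _ ?_)
  have e : (a * (σ g)⁻¹, (1 : G), (1 : T)) = (a, g, 1) * (σ g, g, 1)⁻¹ := by simp
  rw [e]
  exact mul_mem h (inv_mem (MulAction.mem_stabilizer_iff.2 (hx.1 g)))

variable [Finite G]

theorem isGraphPoint_twistedPt {ρ : MulAut G} {U : GSet (T × Subgroup.center G)}
    (hU : U.IsFibred) (x : G) (u : U.carrier) :
    IsGraphPoint σ (GSet.twisted ρ U) (twistedPt ρ x u) ↔ ∀ g, σ g * x = x * ρ g := by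
  -- As `U` is `Z(G)`-free, only `z = 1` can identify two points with the same `u`.
  have key : ∀ a b : G, (a, b, (1 : T)) • twistedPt ρ x u = twistedPt ρ x u ↔
      a * x = x * ρ b := by
    intro a b
    rw [smul_twistedPt, twistedPt_eq_iff]
    change (∃ z : Subgroup.center G, a * x * (ρ b)⁻¹ * (z : G)⁻¹ = x ∧
      ((1 : T), z) • ((1 : T), (1 : Subgroup.center G)) • u = u) ↔ _
    rw [show ((1 : T), (1 : Subgroup.center G)) • u = u from one_smul _ u]
    constructor
    · rintro ⟨z, h1, h2⟩
      rw [hU z u h2, Subgroup.coe_one, inv_one, mul_one] at h1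
      exact mul_inv_eq_iff_eq_mul.1 h1
    · intro h
      exact ⟨1, by rw [h, Subgroup.coe_one, inv_one, mul_one, mul_inv_cancel_right],
        one_smul _ u⟩
  refine ⟨fun h g => (key _ _).1 (h.1 g), fun h => ⟨fun g => (key _ _).2 (h g), fun a ha => ?_⟩⟩
  rw [key, map_one, mul_one, mul_eq_right] at ha
  exact ha

theorem graphFix_twisted_isEmpty {ρ : MulAut G} (h : (σ : Out G) ≠ (ρ : Out G))
    {U : GSet (T × Subgroup.center G)} (hU : U.IsFibred) :
    IsEmpty (GSet.graphFix σ (GSet.twisted ρ U)).carrier := by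
  refine ⟨?_⟩
  rintro ⟨w, hw⟩
  revert w
  refine twistedPt_ind fun x u hw => ?_
  rw [isGraphPoint_twistedPt hU] at hw
  -- `σ g x = x ρ g` says that `σ` and `ρ` differ by conjugation by `x`.
  refine h (QuotientGroup.eq.2 ⟨(σ⁻¹ x)⁻¹, ?_⟩)
  ext g
  simp only [MulAut.conj_apply, inv_inv, MulAut.mul_apply]
  apply σ.injective
  simp [mul_assoc, hw g]

theorem graphFix_twisted_iso {U : GSet (T × Subgroup.center G)} (hU : U.IsFibred) :
    U.Iso (GSet.graphFix σ (GSet.twisted σ U)) := by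
  refine ⟨Equiv.ofBijective (fun u => ⟨twistedPt σ 1 u,
    (isGraphPoint_twistedPt hU 1 u).2 fun g => by simp⟩) ⟨?_, ?_⟩, fun r u => Subtype.ext ?_⟩
  · intro u u' h
    obtain ⟨z, h1, h2⟩ := twistedPt_eq_iff.1 (congrArg Subtype.val h)
    rw [one_mul, inv_eq_one, OneMemClass.coe_eq_one] at h1
    rw [← h2, h1]
    exact (one_smul _ u).symm
  · rintro ⟨w, hw⟩
    revert w
    refine twistedPt_ind fun x u hw => ?_
    have hx : x ∈ Subgroup.center G := Subgroup.mem_center_iff.2 fun g => by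
      obtain ⟨g, rfl⟩ := σ.surjective g
      exact (isGraphPoint_twistedPt hU x u).1 hw g
    refine ⟨((1 : T), (⟨x, hx⟩ : Subgroup.center G)) • u, Subtype.ext ?_⟩
    change twistedPt σ 1 _ = twistedPt σ x u
    rw [← twistedPt_mul, one_mul]
  · change twistedPt σ 1 (r • u) = centralHom G T r • twistedPt σ 1 u
    rw [smul_twistedPt]
    change _ = twistedPt σ ((r.2 : G) * 1 * (σ 1)⁻¹) ((r.1, (1 : Subgroup.center G)) • u)
    rw [map_one, inv_one, mul_one, mul_one, ← one_mul (r.2 : G), twistedPt_mul, smul_smul]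
    simp

variable (T σ)

/-- The additive extension of `X ↦ GSet.graphFix σ X`. -/
def graphFixB : EndB G T →+ FibB T (Subgroup.center G) :=
  ((FibB.of T _).toAddMonoidHom.comp
    (BurnsideGroup.liftGSet (fun X => BurnsideGroup.cls (GSet.graphFix σ X))
      (fun _ _ h => BurnsideGroup.cls_eq (graphFix_iso h))
      (fun X Y => (BurnsideGroup.cls_eq (graphFix_sum X Y)).trans (cls_sum _ _)))).comp
    EndB.of.symm.toAddMonoidHom

variable (k : Type v) [CommRing k]

/-- The `k`-linear extension of `X ↦ GSet.graphFix σ X`. -/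
def graphFixK : KEndB k G T →ₗ[k] KFibB T (Subgroup.center G) k :=
  (graphFixB T σ).toIntLinearMap.baseChange k

variable {T}

theorem graphFixK_endCls (X : GSet (G × G × T)) :
    graphFixK T σ k (endCls k X) = fibCls k (GSet.graphFix σ X) := by
  refine (LinearMap.baseChange_tmul _ _ _).trans ?_
  exact congrArg (fun b => (1 : k) ⊗ₜ[ℤ] FibB.of T _ b) (BurnsideGroup.liftGSet_cls _
    (fun _ _ h => BurnsideGroup.cls_eq (graphFix_iso h))
    (fun X Y => (BurnsideGroup.cls_eq (graphFix_sum X Y)).trans (cls_sum _ _)) X)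

theorem fibCls_of_isEmpty (U : GSet (T × Subgroup.center G)) [IsEmpty U.carrier] :
    fibCls k U = 0 := by
  rw [fibCls, cls_of_isEmpty, map_zero, TensorProduct.tmul_zero]

theorem graphFixK_eq_zero {x : KEndB k G T} (hx : x ∈ factorIdeal k G T) :
    graphFixK T σ k x = 0 := by
  refine Submodule.span_le (p := LinearMap.ker (graphFixK T σ k)).2 ?_ (factorIdeal_le k hx)
  rintro _ ⟨X, hX, rfl⟩
  have : IsEmpty (GSet.graphFix σ X).carrier := ⟨fun x => x.2.not_starDecomposable (hX x.1)⟩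
  exact (graphFixK_endCls σ k X).trans (fibCls_of_isEmpty k _)

theorem graphFixK_twistedK (u : MonomialBurnside T (Subgroup.center G) k) :
    graphFixK T σ k (twistedK T k σ (MonomialBurnside.incl k u)) = MonomialBurnside.incl k u := by
  have h : Subalgebra.toSubmodule (monomialSubalgebra T (Subgroup.center G) k) ≤
      LinearMap.eqLocus ((graphFixK T σ k).comp (twistedK T k σ)) LinearMap.id := by
    refine Submodule.span_le.2 ?_
    rintro _ ⟨U, hU, rfl⟩
    change graphFixK T σ k (twistedK T k σ (fibCls k U)) = fibCls k U
    rw [twistedK_fibCls, graphFixK_endCls, fibCls, fibCls,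
      BurnsideGroup.cls_eq (graphFix_twisted_iso hU)]
  exact h u.2

theorem graphFixK_twistedK_of_ne {ρ : MulAut G} (hρ : (σ : Out G) ≠ (ρ : Out G))
    (u : MonomialBurnside T (Subgroup.center G) k) :
    graphFixK T σ k (twistedK T k ρ (MonomialBurnside.incl k u)) = 0 := by
  have h : Subalgebra.toSubmodule (monomialSubalgebra T (Subgroup.center G) k) ≤
      LinearMap.ker ((graphFixK T σ k).comp (twistedK T k ρ)) := by
    refine Submodule.span_le.2 ?_
    rintro _ ⟨U, hU, rfl⟩
    have := graphFix_twisted_isEmpty hρ hU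
    change graphFixK T σ k (twistedK T k ρ (fibCls k U)) = 0
    rw [twistedK_fibCls, graphFixK_endCls, fibCls_of_isEmpty]
  exact h u.2

theorem graphFixK_semidirectHom (s : Out G) (x : SemidirectOut G k T) :
    graphFixK T s.out k (semidirectHom G T k x) = MonomialBurnside.incl k (x.coeff s) := by
  classical
  induction x using SkewMonoidAlgebra.induction_on' with
  | add a b ha hb =>
    rw [map_add, map_add, ha, hb, SkewMonoidAlgebra.coeff_add, Finsupp.add_apply, map_add]
  | single t u =>
    rw [semidirectHom_single, SkewMonoidAlgebra.coeff_single_apply]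
    split_ifs with h
    · rw [h, graphFixK_twistedK]
    · rw [graphFixK_twistedK_of_ne, map_zero]
      rw [QuotientGroup.out_eq', QuotientGroup.out_eq']
      exact fun e => h e.symm

variable (G T)

/-- The composite of `semidirectHom` with the projection onto the essential algebra. -/
def semidirectEss [Finite T] : SemidirectOut G k T →ₐ[k] EssentialAlgebra k G T :=
  (essProj k G T).comp (semidirectHom G T k)

theorem semidirectEss_injective [Finite T] : Function.Injective (semidirectEss G T k) := by
  refine (injective_iff_map_eq_zero _).2 fun x hx => ?_
  have h : semidirectHom G T k x ∈ factorIdeal k G T := Ideal.Quotient.eq_zero_iff_mem.1 hx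
  ext s
  apply MonomialBurnside.incl_injective
  rw [← graphFixK_semidirectHom, graphFixK_eq_zero _ _ h]
  rfl

end GraphFix

/-! ### The isomorphism and the basis -/

section Main

variable {G T : Type u} [Group G] [Group T] [Finite G] [Finite T]

theorem isFibred_coset_prod (T₀ : Subgroup T) :
    (GSet.coset (T₀.prod (⊥ : Subgroup (Subgroup.center G)))).IsFibred := by
  intro z x h
  obtain ⟨r, rfl⟩ := coset_transitive _ x
  rw [smul_smul, smul_cosetOne_eq_iff] at h
  have := Subgroup.mem_bot.1 (Subgroup.mem_prod.1 h).2
  simpa using this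

/-- The set `G ×_{Z(G)} (T × Z(G)) / (T₀ × 1)` is transitive, and the stabilizer of the class
of `(1, 1)` is `D_{σ, 1, T₀}`. -/
theorem twisted_coset_iso (σ : MulAut G) (T₀ : Subgroup T) :
    (GSet.twisted σ (GSet.coset (T₀.prod (⊥ : Subgroup (Subgroup.center G))))).Iso
      (GSet.coset (directSubgroup σ T₀ 1)) := by
  have h := GSet.iso_coset
    (GSet.twisted σ (GSet.coset (T₀.prod (⊥ : Subgroup (Subgroup.center G)))))
    (twistedPt σ 1 (GSet.cosetOne _)) ?_
  · convert h using 2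
    ext ⟨a, b, t⟩
    rw [mem_directSubgroup_one, MulAction.mem_stabilizer_iff, smul_twistedPt, twistedPt_eq_iff]
    change _ ↔ ∃ z : Subgroup.center G, a * 1 * (σ b)⁻¹ * (z : G)⁻¹ = 1 ∧
      ((1 : T), z) • (t, (1 : Subgroup.center G)) • GSet.cosetOne _ = GSet.cosetOne _
    have hz : ∀ z : Subgroup.center G, (((1 : T), z) • (t, (1 : Subgroup.center G)) •
        GSet.cosetOne (T₀.prod (⊥ : Subgroup (Subgroup.center G))) = GSet.cosetOne _) ↔
        t ∈ T₀ ∧ z = 1 := by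
      intro z
      rw [smul_smul, Prod.mk_mul_mk, one_mul, mul_one, ← MulAction.mem_stabilizer_iff,
        stabilizer_coset_one, Subgroup.mem_prod, Subgroup.mem_bot]
    simp only [hz]
    constructor
    · rintro ⟨h1, rfl⟩
      exact ⟨1, by simp, h1, rfl⟩
    · rintro ⟨z, h1, h2, rfl⟩
      refine ⟨h2, ?_⟩
      simpa [mul_inv_eq_one] using h1
  · refine twistedPt_ind fun x q => ?_
    obtain ⟨⟨t, z⟩, rfl⟩ := coset_transitive _ q
    refine ⟨(x * z, 1, t), ?_⟩
    rw [smul_twistedPt]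
    change twistedPt σ (x * z * 1 * (σ 1)⁻¹) ((t, (1 : Subgroup.center G)) • _) = _
    rw [map_one, inv_one, mul_one, mul_one, twistedPt_mul, smul_smul, Prod.mk_mul_mk, one_mul,
      mul_one]

variable (k : Type v) [CommRing k]

omit [Finite T] in
theorem endCls_twisted_mem_range {U : GSet (T × Subgroup.center G)} (hU : U.IsFibred) (σ : MulAut G) :
    endCls k (GSet.twisted σ U) ∈ (semidirectHom G T k).range := by
  refine ⟨SkewMonoidAlgebra.single (σ : Out G)
    ⟨fibCls k U, Submodule.subset_span ⟨U, hU, rfl⟩⟩, ?_⟩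
  refine (semidirectHom_single G T k _ _).trans ?_
  change twistedK T k (σ : Out G).out (fibCls k U) = _
  rw [twistedK_eq_of_out_eq k (QuotientGroup.out_eq' (σ : Out G)), twistedK_fibCls]

theorem semidirectEss_surjective (hGT : Nat.Coprime (Nat.card G) (Nat.card T)) :
    Function.Surjective (semidirectEss G T k) := by
  suffices h : LinearMap.range (semidirectEss G T k).toLinearMap = ⊤ from
    LinearMap.range_eq_top.1 h
  rw [← top_le_iff, ← span_directSubgroup k hGT, Submodule.span_le]
  rintro _ ⟨σ, T₀, rfl⟩
  obtain ⟨x, hx⟩ := endCls_twisted_mem_range k (isFibred_coset_prod (G := G) T₀) σ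
  refine ⟨x, congrArg (essProj k G T) (hx.trans ?_)⟩
  exact endCls_eq k (twisted_coset_iso σ T₀)

/-- The `k`-linear extension of the number of orbits isomorphic to `(G × G × T) / D`. -/
def orbitCountK (D : Subgroup (G × G × T)) : KEndB k G T →ₗ[k] k :=
  (TensorProduct.AlgebraTensorModule.rid ℤ k k).toLinearMap.comp
    (((orbitCountB D).comp EndB.of.symm.toAddMonoidHom).toIntLinearMap.baseChange k)

omit [Finite T] in
theorem orbitCountK_endCls (D : Subgroup (G × G × T)) (X : GSet (G × G × T)) :
    orbitCountK k D (endCls k X) = X.orbitCount D := by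
  have h : ((orbitCountB D).comp EndB.of.symm.toAddMonoidHom).toIntLinearMap
      (EndB.of (BurnsideGroup.cls X)) = (X.orbitCount D : ℤ) := orbitCountB_cls D X
  rw [orbitCountK, endCls, LinearMap.comp_apply, LinearMap.baseChange_tmul, h]
  simp

omit [Finite T] in
theorem orbitCountK_eq_zero {D : Subgroup (G × G × T)} (hD : ¬ StarDecomposable D)
    {x : KEndB k G T} (hx : x ∈ factorIdeal k G T) : orbitCountK k D x = 0 := by
  refine Submodule.span_le (p := LinearMap.ker (orbitCountK k D)).2 ?_ (factorIdeal_le k hx)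
  rintro _ ⟨X, hX, rfl⟩
  refine (orbitCountK_endCls k D X).trans ?_
  rw [GSet.orbitCount_eq_zero fun x (h : MulAction.stabilizer (G × G × T) x = D) => hD (h ▸ hX x),
    Nat.cast_zero]

/-- The elements of `𝓛_{s'}` are linearly independent: the number of orbits isomorphic
to `(G × G × T) / D`, for `D` indecomposable, vanishes on the ideal `I_T(G)`. -/
theorem setLs_linearIndependent :
    LinearIndependent k (fun x : setLs k G T => (x : EssentialAlgebra k G T)) := by
  classical
  have hD : ∀ x : setLs k G T, ∃ D : Subgroup (G × G × T), ¬ StarDecomposable D ∧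
    (x : EssentialAlgebra k G T) = essProj k G T (transCls k G T D) := fun x => x.2
  choose D hD hx using hD
  rw [linearIndependent_iff']
  intro s c hc x hxs
  have h0 : ∑ y ∈ s, c y • transCls k G T (D y) ∈ factorIdeal k G T := by
    refine Ideal.Quotient.eq_zero_iff_mem.1 ?_
    change essProj k G T _ = 0
    rw [map_sum, ← hc]
    refine Finset.sum_congr rfl fun y _ => ?_
    rw [map_smul, hx]
  have h1 := orbitCountK_eq_zero k (hD x) h0
  have h2 : ∀ y, y ≠ x → orbitCountK k (D x) (transCls k G T (D y)) = 0 := by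
    intro y hy
    refine (orbitCountK_endCls k (D x) _).trans ?_
    by_contra hn
    have hi := coset_iso_of_orbitCount_ne_zero (fun h => hn (by rw [h, Nat.cast_zero]))
    refine hy (Subtype.ext ?_)
    rw [hx, hx]
    exact congrArg _ (endCls_eq k hi)
  have h3 : orbitCountK k (D x) (transCls k G T (D x)) = 1 := by
    refine (orbitCountK_endCls k (D x) _).trans ?_
    rw [orbitCount_coset_self, Nat.cast_one]
  rw [map_sum, Finset.sum_eq_single x (fun y _ hy => by rw [map_smul, h2 y hy, smul_zero])
    (fun h => (h hxs).elim), map_smul, h3, smul_eq_mul, mul_one] at h1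
  exact h1

theorem span_setLs (hGT : Nat.Coprime (Nat.card G) (Nat.card T)) :
    Submodule.span k (setLs k G T) = ⊤ := by
  rw [← top_le_iff, ← span_directSubgroup k hGT]
  refine Submodule.span_mono ?_
  rintro _ ⟨σ, T₀, rfl⟩
  exact ⟨_, directSubgroup_not_starDecomposable σ T₀ 1, rfl⟩

end Main

end

end ShiftedBurnside

open ShiftedBurnside
theorem corollary3p5 (k : Type v) [CommRing k] (G T : Type u) [Group G] [Finite G] [Group T]
    [Finite T] (hGT : Nat.Coprime (Nat.card G) (Nat.card T)) :
    (setLp k G T = setLs k G T ∧ setLs k G T = setG k G T) ∧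
    (∃ b : Module.Basis (setG k G T) k (EssentialAlgebra k G T),
      ∀ x : setG k G T, b x = (x : EssentialAlgebra k G T)) ∧
    Nonempty (EssentialAlgebra k G T ≃ₐ[k] SemidirectOut G k T) ∧
    Nonempty (KEndB k G T ≃ₗ[k] (SemidirectOut G k T × factorIdeal k G T)) := by
  have hbij : Function.Bijective (semidirectEss G T k) :=
    ⟨semidirectEss_injective G T k, semidirectEss_surjective k hGT⟩
  refine ⟨⟨setLp_eq_setLs k hGT, setLs_eq_setG k hGT⟩, ?_,
    ⟨(AlgEquiv.ofBijective _ hbij).symm⟩, ?_⟩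
  · rw [← setLs_eq_setG k hGT]
    refine ⟨Module.Basis.mk (setLs_linearIndependent k) ?_, fun x => Module.Basis.mk_apply _ _ _⟩
    rw [Subtype.range_coe, span_setLs k hGT]
  -- `semidirectHom` splits the projection onto the essential algebra.
  · let L : (SemidirectOut G k T × factorIdeal k G T) →ₗ[k] KEndB k G T :=
      (semidirectHom G T k).toLinearMap.coprod ((factorIdeal k G T).subtype.restrictScalars k)
    have hL : ∀ a i, L (a, i) = semidirectHom G T k a + i := fun a i => rfl
    refine ⟨(LinearEquiv.ofBijective L ⟨?_, fun x => ?_⟩).symm⟩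
    · rintro ⟨a, i⟩ ⟨b, j⟩ h
      rw [hL, hL] at h
      have hI : ∀ i : factorIdeal k G T, essProj k G T (i : KEndB k G T) = 0 :=
        fun i => Ideal.Quotient.eq_zero_iff_mem.2 i.2
      have hab : semidirectEss G T k a = semidirectEss G T k b := by
        have := congrArg (essProj k G T) h
        rwa [map_add, map_add, hI, hI, add_zero, add_zero] at this
      obtain rfl := hbij.1 hab
      exact congrArg (Prod.mk a) (Subtype.ext (add_left_cancel h))
    · obtain ⟨a, ha⟩ := hbij.2 (essProj k G T x)
      exact ⟨(a, ⟨x - semidirectHom G T k a, Ideal.Quotient.eq.1 ha.symm⟩),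
        (hL _ _).trans (add_sub_cancel _ _)⟩
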